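/- Let $k$ be a field. For $\theta\in S^1$ and $\xi_1,\xi_2\in\mathbb C$ write $\xi_1<_\theta\xi_2$ if $\operatorname{Re}(\xi_1e^{-i\theta})<\operatorname{Re}(\xi_2e^{-i\theta})$. For $\xi\in\mathbb C$ let $i_\xi\colon S^1\to\mathbb C^*$, $\theta\mapsto e^{\operatorname{Re}(\xi e^{-i\theta})}e^{i\theta}$, let $S_\xi$ be its image, and for $z=\lambda e^{i\theta}\in\mathbb C^*$ write $S_\xi<z$ if $\lambda>e^{\operatorname{Re}(\xi e^{-i\theta})}$. Let $\pi\colon\mathbb C^*\to S^1$, $\lambda e^{i\theta}\mapsto\theta$. Local systems are locally constant sheaves of finite dimensional $k$-vector spaces. A co-Stokes structure of exponential type with exponents a finite set $E\subset\mathbb C$ is a local system $\mathcal L$ on $S^1$ with subsheaves $\mathcal L_{<\xi}$ $(\xi\in\mathbb C)$ such that $\xi_1<_\theta\xi_2$ implies $\mathcal L_{<\xi_1,\theta}\subset\mathcal L_{<\xi_2,\theta}$, and such that there are local systems $\operatorname{gr}_c\mathcal L$ $(c\in E)$ on $S^1$ for which, locally on $S^1$, $(\mathcal L,(\mathcal L_{<\xi})_\xi)$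 is isomorphic to $\bigoplus_{c\in E}\operatorname{gr}_c\mathcal L$ with the subsheaves $\bigoplus_{c\in E}j_!j^*\operatorname{gr}_c\mathcal L$, where $j$ is the inclusion of $\{\theta\mid c<_\theta\xi\}$ into $S^1$. Morphisms are the morphisms of sheaves compatible with all the subsheaves; $\mathrm{Sto}_<$ is the category of these objects for all finite sets $E$. A co-Stokes sheaf with exponents $E$ is a local system $\mathcal L$ on $\mathbb C^*$ with a subsheaf $\mathcal G$ such that each point of $\mathbb C^*$ has an open neighbourhood $U$ on which $\mathcal L$ is constant and has a decomposition $\mathcal L|_U=\bigoplus_{c\in E}\operatorname{gr}_c\mathcal L$ into constant sheaves with $\mathcal G_{z}=\bigoplus_{S_c<z}(\operatorname{gr}_c\mathcal L)_z$ for all $z\in U$. Morphisms are the morphisms of sheaves that map the subsheaves to each other; $\mathrm{SSh}$ is the category of these objects for all finite sets $E$. Theorem. (1) For a co-Stokes structure $(\mathcal L,\mathcal L_<)$ with exponents $E$, let $\mathcal G\subset\pi^*\mathcal L$ be the subsheaf of the sections whose germ at each $z$ lies in $\mathcal L_{<\xi,\pi(z)}\subset\mathcal L_{\pi(z)}=(\pi^*\mathcal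 L)_z$ for all $\xi$ with $z\in S_\xi$. Then $\mathcal G_z=\mathcal L_{<\xi,\pi(z)}$ whenever $z\in S_\xi$, the pair $(\pi^*\mathcal L,\mathcal G)$ is a co-Stokes sheaf with exponents $E$, and the functor $\sigma\colon\mathrm{Sto}_<\to\mathrm{SSh}$, $(\mathcal L,\mathcal L_<)\mapsto(\pi^*\mathcal L,\mathcal G)$, $f\mapsto\pi^*f$, is an equivalence of categories. (2) For a co-Stokes sheaf $(\mathcal L,\mathcal G)$ with exponents $E$ and a circle $S_\infty$ around $0$ encircling all $S_c$, $c\in E$, with $i_\infty\colon S^1\to S_\infty$ the rescaling, regard $i_\xi^*\mathcal G$ as a subsheaf of $i_\infty^*\mathcal L$ by identifying the stalks of $\mathcal L$ along each ray $\mathbb R_{>0}e^{i\theta}$. Then $(i_\infty^*\mathcal L,(i_\xi^*\mathcal G)_\xi)$ is a co-Stokes structure with exponents $E$, whose $\xi$-th subsheaf has stalk $\mathcal G_{i_\xi(\theta)}$ at $\theta$. For any choice of such a circle for each co-Stokes sheaf, this extends to a functor $\tau\colon\mathrm{SSh}\to\mathrm{Sto}_<$, given on morphisms by restriction to the circles $S_\infty$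 (circles of different radii being identified along the rays), and $\tau$ is a quasi-inverse of $\sigma$. -/

import Mathlib

open CategoryTheory TopologicalSpace Opposite

universe u

attribute [local instance 2000] CategoryTheory.CategoryStruct.toQuiver

noncomputable section

namespace CoStokes

/-! ### Sheaves of `k`-vector spaces and their subsheaves -/

section Sheaves

variable (k : Type u) [Field k]

/-- Sheaves of `k`-vector spaces on a topological space. -/
abbrev Sh (X : TopCat.{u}) := TopCat.Sheaf (ModuleCat.{u} k) X

variable {k} {X Y : TopCat.{u}}

/-- The vector space `F(U)`. -/
abbrev Sec (F : Sh k X) (U : Opens X) : ModuleCat.{u} k := F.presheaf.obj (op U)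

/-- The restriction map `F(U) → F(V)` for `V ⊆ U`. -/
def res (F : Sh k X) {U V : Opens X} (h : V ≤ U) : Sec F U →ₗ[k] Sec F V :=
  (F.presheaf.map (homOfLE h).op).hom

/-- The stalk `F_x`. -/
abbrev Stalk (F : Sh k X) (x : X) : ModuleCat.{u} k := TopCat.Presheaf.stalk F.presheaf x

/-- The germ map `F(U) → F_x` for `x ∈ U`. -/
def germ (F : Sh k X) (U : Opens X) (x : X) (hx : x ∈ U) : Sec F U →ₗ[k] Stalk F x :=
  (TopCat.Presheaf.germ F.presheaf U x hx).hom

/-- The map `F(U) → F'(U)` of a morphism of sheaves. -/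
def onSec {F F' : Sh k X} (f : F ⟶ F') (U : Opens X) : Sec F U →ₗ[k] Sec F' U :=
  (f.hom.app (op U)).hom

/-- The map `F_x → F'_x` of a morphism of sheaves. -/
def onStalk {F F' : Sh k X} (f : F ⟶ F') (x : X) : Stalk F x →ₗ[k] Stalk F' x :=
  ((TopCat.Presheaf.stalkFunctor (ModuleCat.{u} k) x).map f.hom).hom

lemma germ_res (F : Sh k X) {U V : Opens X} (h : V ≤ U) (x : X) (hx : x ∈ V) (s : Sec F U) :
    germ F V x hx (res F h s) = germ F U x (h hx) s :=
  TopCat.Presheaf.germ_res_apply F.presheaf (homOfLE h) x hx s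

lemma onStalk_germ {F F' : Sh k X} (f : F ⟶ F') (U : Opens X) (x : X) (hx : x ∈ U)
    (s : Sec F U) : onStalk f x (germ F U x hx s) = germ F' U x hx (onSec f U s) :=
  TopCat.Presheaf.stalkFunctor_map_germ_apply U x hx f.hom s

/-- A subsheaf (of vector spaces) of `F`. -/
@[ext]
structure Subsheaf (F : Sh k X) where
  sec : ∀ U : Opens X, Submodule k (Sec F U)
  res_mem : ∀ {U V : Opens X} (h : V ≤ U) {s : Sec F U}, s ∈ sec U → res F h s ∈ sec V
  mem_of_locally : ∀ {U : Opens X} (s : Sec F U),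
    (∀ x ∈ U, ∃ (V : Opens X) (h : V ≤ U), x ∈ V ∧ res F h s ∈ sec V) → s ∈ sec U

namespace Subsheaf

/-- The stalk `G_x`, as a subspace of `F_x`. -/
def stalk {F : Sh k X} (G : Subsheaf F) (x : X) : Submodule k (Stalk F x) where
  carrier := {a | ∃ (U : Opens X) (hx : x ∈ U), ∃ s ∈ G.sec U, germ F U x hx s = a}
  zero_mem' := ⟨⊤, trivial, 0, zero_mem _, map_zero _⟩
  add_mem' := by
    rintro _ _ ⟨U, hU, s, hs, rfl⟩ ⟨V, hV, t, ht, rfl⟩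
    have hx : x ∈ U ⊓ V := ⟨hU, hV⟩
    exact ⟨U ⊓ V, hx, res F inf_le_left s + res F inf_le_right t,
      add_mem (G.res_mem _ hs) (G.res_mem _ ht), by rw [map_add, germ_res, germ_res]⟩
  smul_mem' := by
    rintro a _ ⟨U, hU, s, hs, rfl⟩
    exact ⟨U, hU, a • s, Submodule.smul_mem _ _ hs, map_smul _ _ _⟩

/-- The subsheaf of the sections of `F` all of whose germs lie in given subspaces of the stalks. -/
def ofStalks (F : Sh k X) (P : ∀ x, Submodule k (Stalk F x)) : Subsheaf F where
  sec U :=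
    { carrier := {s | ∀ x (hx : x ∈ U), germ F U x hx s ∈ P x}
      zero_mem' := fun x hx => by rw [map_zero]; exact zero_mem _
      add_mem' := fun hs ht x hx => by rw [map_add]; exact add_mem (hs x hx) (ht x hx)
      smul_mem' := fun a s hs x hx => by
        rw [map_smul]; exact Submodule.smul_mem _ _ (hs x hx) }
  res_mem h _ hs x hx := by rw [germ_res]; exact hs x (h hx)
  mem_of_locally s hs x hx := by
    obtain ⟨V, h, hxV, hV⟩ := hs x hx
    have := hV x hxV
    rwa [germ_res] at this

end Subsheaf

open Classical in
/-- For `O` open with inclusion `j`, this is `j_! j^* F` as a subsheaf of `F`: the sections of `F`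
supported in `O`, that is, whose germs vanish outside `O`. -/
def extByZero (F : Sh k X) (O : Set X) : Subsheaf F :=
  Subsheaf.ofStalks F fun x => if x ∈ O then ⊤ else ⊥

/-- The inverse image functor `f^*` on sheaves. -/
abbrev pull (k : Type u) [Field k] (f : X ⟶ Y) : Sh k Y ⥤ Sh k X :=
  TopCat.Sheaf.pullback (ModuleCat.{u} k) f

/-- The canonical map `F_{f x} → (f^* F)_x`. -/
def pullStalk (f : X ⟶ Y) (F : Sh k Y) (x : X) :
    Stalk F (f x) →ₗ[k] Stalk ((pull k f).obj F) x :=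
  ((TopCat.Presheaf.stalkFunctor (ModuleCat.{u} k) (f x)).map
      ((TopCat.Sheaf.pullbackPushforwardAdjunction (ModuleCat.{u} k) f).unit.app F).hom ≫
    TopCat.Presheaf.stalkPushforward (ModuleCat.{u} k) f ((pull k f).obj F).presheaf x).hom

/-- The canonical map `F(U) → (f^* F)(f⁻¹ U)`. -/
def pullSec (f : X ⟶ Y) (F : Sh k Y) (U : Opens Y) :
    Sec F U →ₗ[k] Sec ((pull k f).obj F) ((Opens.map f).obj U) :=
  (((TopCat.Sheaf.pullbackPushforwardAdjunction (ModuleCat.{u} k) f).unit.app F).hom.app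
    (op U)).hom

lemma pullStalk_germ (f : X ⟶ Y) (F : Sh k Y) (x : X) (U : Opens Y) (hU : f x ∈ U)
    (hU' : x ∈ (Opens.map f).obj U) (s : Sec F U) :
    pullStalk f F x (germ F U (f x) hU s) =
      germ ((pull k f).obj F) ((Opens.map f).obj U) x hU' (pullSec f F U s) := by
  have h := TopCat.Presheaf.stalkFunctor_map_germ_apply U (f x) hU
    ((TopCat.Sheaf.pullbackPushforwardAdjunction (ModuleCat.{u} k) f).unit.app F).hom s
  have h' := ConcreteCategory.congr_hom (TopCat.Presheaf.stalkPushforward_germ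
    (ModuleCat.{u} k) f ((pull k f).obj F).presheaf U x hU) (pullSec f F U s)
  refine Eq.trans ?_ h'
  exact congrArg (TopCat.Presheaf.stalkPushforward (ModuleCat.{u} k) f
    ((pull k f).obj F).presheaf x).hom h

lemma onStalk_pullStalk (f : X ⟶ Y) {F F' : Sh k Y} (φ : F ⟶ F') (x : X)
    (a : Stalk F (f x)) :
    onStalk ((pull k f).map φ) x (pullStalk f F x a) = pullStalk f F' x (onStalk φ (f x) a) := by
  obtain ⟨U, hU, s, rfl⟩ := TopCat.Presheaf.exists_germ_eq F.presheaf a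
  have hU' : x ∈ (Opens.map f).obj U := hU
  change onStalk _ x (pullStalk f F x (germ F U (f x) hU s)) =
    pullStalk f F' x (onStalk φ (f x) (germ F U (f x) hU s))
  rw [pullStalk_germ f F x U hU hU', onStalk_germ, onStalk_germ, pullStalk_germ f F' x U hU hU']
  have h := (TopCat.Sheaf.pullbackPushforwardAdjunction (ModuleCat.{u} k) f).unit.naturality φ
  have h' : onSec ((pull k f).map φ) ((Opens.map f).obj U) (pullSec f F U s) =
      pullSec f F' U (onSec φ U s) := (congrArg (fun g => onSec g U s) h).symm
  rw [h']

/-- An isomorphism of `F|_U` with the constant sheaf on `U` with fibre `M`, the sheaf of locally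
constant functions with values in `M`. -/
structure ConstantOn (F : Sh k X) (U : Opens X) (M : ModuleCat.{u} k) where
  equiv : ∀ V : Opens X, V ≤ U → (Sec F V ≃ₗ[k] LocallyConstant V M)
  equiv_res : ∀ {V W : Opens X} (hV : V ≤ U) (hW : W ≤ V) (s : Sec F V) (x : W),
    equiv W (hW.trans hV) (res F hW s) x = equiv V hV s ⟨x.1, hW x.2⟩

/-- Local systems of finite dimensional vector spaces: locally constant sheaves with finite
dimensional fibres. -/
def IsLocalSystem (F : Sh k X) : Prop :=
  ∀ x : X, ∃ U : Opens X, x ∈ U ∧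
    ∃ M : ModuleCat.{u} k, Module.Finite k M ∧ Nonempty (ConstantOn F U M)

end Sheaves

/-! ### The spaces and the curves `S_ξ` -/

/-- The circle `S¹` (lifted to the universe of the field of coefficients). -/
abbrev S1 : TopCat.{u} := TopCat.of (ULift.{u} Circle)

/-- The punctured plane `ℂ*` (lifted to the universe of the field of coefficients). -/
abbrev Cstar : TopCat.{u} := TopCat.of (ULift.{u} {z : ℂ // z ≠ 0})

/-- `ξ₁ <_θ ξ₂`, that is `Re (ξ₁ e^{-iθ}) < Re (ξ₂ e^{-iθ})`, for the point `w = e^{iθ}`. -/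
def LtAt (w : S1.{u}) (ξ₁ ξ₂ : ℂ) : Prop :=
  (ξ₁ * (w.down : ℂ)⁻¹).re < (ξ₂ * (w.down : ℂ)⁻¹).re

/-- The projection `π : ℂ* → S¹`, `r e^{iθ} ↦ e^{iθ}`. -/
def proj : Cstar.{u} ⟶ S1.{u} :=
  TopCat.ofHom
    { toFun := fun z => ⟨⟨z.down.1 / ‖z.down.1‖, by
        have := z.down.2
        simp [Submonoid.unitSphere, this]⟩⟩
      continuous_toFun := by
        refine continuous_uliftUp.comp (Continuous.subtype_mk ?_ _)
        have h : Continuous fun z : Cstar.{u} => z.down.1 :=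
          continuous_subtype_val.comp continuous_uliftDown
        refine h.div (Complex.continuous_ofReal.comp h.norm) fun z => ?_
        simpa using z.down.2 }

/-- The inclusion `S¹ → ℂ*`, `e^{iθ} ↦ r e^{iθ}` of the circle of radius `r > 0` around `0`. -/
def circ (r : Set.Ioi (0 : ℝ)) : S1.{u} ⟶ Cstar.{u} :=
  TopCat.ofHom
    { toFun := fun w => ⟨⟨(r : ℝ) * (w.down : ℂ), by
        have : (r : ℝ) ≠ 0 := r.2.ne'
        simp [this]⟩⟩
      continuous_toFun := by
        refine continuous_uliftUp.comp (Continuous.subtype_mk ?_ _)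
        exact continuous_const.mul (continuous_subtype_val.comp continuous_uliftDown) }

/-- The parametrization `i_ξ : S¹ → ℂ*`, `e^{iθ} ↦ exp (Re (ξ e^{-iθ})) e^{iθ}` of `S_ξ`. -/
def param (ξ : ℂ) (w : S1.{u}) : Cstar.{u} :=
  ⟨⟨(Real.exp (ξ * (w.down : ℂ)⁻¹).re : ℝ) * (w.down : ℂ), by
    simp [-Complex.ofReal_exp, Real.exp_ne_zero]⟩⟩

/-- The curve `S_ξ ⊆ ℂ*`. -/
def curve (ξ : ℂ) : Set Cstar.{u} :=
  {z | ‖z.down.1‖ = Real.exp (ξ * ((proj z).down : ℂ)⁻¹).re}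

/-- `S_ξ < z`: the point `z` lies strictly outside the curve `S_ξ`. -/
def Outside (ξ : ℂ) (z : Cstar.{u}) : Prop :=
  Real.exp (ξ * ((proj z).down : ℂ)⁻¹).re < ‖z.down.1‖

/-- The open ray `ℝ_{>0} w` through `w ∈ S¹`. -/
def ray (w : S1.{u}) : Set Cstar.{u} := {z | proj z = w}

lemma proj_real_mul (a : ℝ) (ha : 0 < a) (w : S1.{u}) (h : (a : ℂ) * (w.down : ℂ) ≠ 0) :
    proj (⟨⟨(a : ℂ) * (w.down : ℂ), h⟩⟩ : Cstar.{u}) = w := by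
  apply ULift.ext
  apply Circle.ext
  change (a : ℂ) * (w.down : ℂ) / (‖(a : ℂ) * (w.down : ℂ)‖ : ℝ) = w.down
  have : (a : ℂ) ≠ 0 := by exact_mod_cast ha.ne'
  have h1 : ‖(w.down : ℂ)‖ = 1 := Circle.norm_coe _
  rw [norm_mul, h1, mul_one, Complex.norm_real, Real.norm_of_nonneg ha.le]
  field_simp

lemma circ_mem_ray (r : Set.Ioi (0 : ℝ)) (w : S1.{u}) : circ r w ∈ ray w :=
  proj_real_mul _ r.2 w _

lemma param_mem_ray (ξ : ℂ) (w : S1.{u}) : param ξ w ∈ ray w :=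
  proj_real_mul _ (Real.exp_pos _) w _

/-! ### Co-Stokes structures of exponential type -/

section Categories

variable (k : Type u) [Field k]

/-- A sheaf on `S¹` with a family of subsheaves `L_{<ξ}` indexed by `ξ ∈ ℂ`. -/
structure FilteredSheaf where
  L : Sh k S1.{u}
  fil : ℂ → Subsheaf L

/-- A sheaf on `ℂ*` with a subsheaf. -/
structure SheafPair where
  L : Sh k Cstar.{u}
  G : Subsheaf L

variable {k}

/-- Morphisms of sheaves on `S¹` compatible with the families of subsheaves. -/
@[ext]
structure FilteredSheaf.Hom (S T : FilteredSheaf k) where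
  hom : S.L ⟶ T.L
  map_fil : ∀ (ξ : ℂ) (U : Opens S1.{u}), ∀ s ∈ (S.fil ξ).sec U, onSec hom U s ∈ (T.fil ξ).sec U

instance : Category (FilteredSheaf k) where
  Hom := FilteredSheaf.Hom
  id S := ⟨𝟙 S.L, fun _ _ _ hs => hs⟩
  comp f g := ⟨f.hom ≫ g.hom, fun ξ U s hs => g.map_fil ξ U _ (f.map_fil ξ U s hs)⟩

/-- Morphisms of sheaves on `ℂ*` that restrict to the subsheaves. -/
@[ext]
structure SheafPair.Hom (S T : SheafPair k) where
  hom : S.L ⟶ T.L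
  map_sub : ∀ (U : Opens Cstar.{u}), ∀ s ∈ S.G.sec U, onSec hom U s ∈ T.G.sec U

instance : Category (SheafPair k) where
  Hom := SheafPair.Hom
  id S := ⟨𝟙 S.L, fun _ _ hs => hs⟩
  comp f g := ⟨f.hom ≫ g.hom, fun U s hs => g.map_sub U _ (f.map_sub U s hs)⟩

/-- An isomorphism over `U` of filtered sheaves between `(⨁_c gr_c, ⨁_c j_{ξ!} j_ξ^* gr_c)` and
`(L, L_{<ξ})`, where `j_ξ` is the inclusion of `{θ | c <_θ ξ}` into `S¹`. -/
structure GradedIsoOn (S : FilteredSheaf k) {E : Finset ℂ} (gr : E → Sh k S1.{u})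
    (U : Opens S1.{u}) where
  equiv : ∀ V : Opens S1.{u}, V ≤ U → ((∀ c : E, Sec (gr c) V) ≃ₗ[k] Sec S.L V)
  equiv_res : ∀ {V W : Opens S1.{u}} (hV : V ≤ U) (hW : W ≤ V) (t : ∀ c : E, Sec (gr c) V),
    equiv W (hW.trans hV) (fun c => res (gr c) hW (t c)) = res S.L hW (equiv V hV t)
  mem_fil_iff : ∀ (V : Opens S1.{u}) (hV : V ≤ U) (ξ : ℂ) (t : ∀ c : E, Sec (gr c) V),
    equiv V hV t ∈ (S.fil ξ).sec V ↔
      ∀ c : E, t c ∈ (extByZero (gr c) {w | LtAt w c ξ}).sec V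

/-- `(L, L_<)` is a co-Stokes structure of exponential type with exponents `E`. -/
structure FilteredSheaf.IsCoStokes (E : Finset ℂ) (S : FilteredSheaf k) : Prop where
  isLocalSystem : IsLocalSystem S.L
  stalk_mono : ∀ (w : S1.{u}) (ξ₁ ξ₂ : ℂ), LtAt w ξ₁ ξ₂ →
    (S.fil ξ₁).stalk w ≤ (S.fil ξ₂).stalk w
  graded : ∃ gr : E → Sh k S1.{u}, (∀ c, IsLocalSystem (gr c)) ∧
    ∀ w : S1.{u}, ∃ U : Opens S1.{u}, w ∈ U ∧ Nonempty (GradedIsoOn S gr U)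

/-! ### Co-Stokes sheaves -/

/-- A decomposition `L|_U = ⨁_c gr_c` into constant sheaves on `U` (with fibres `M c`) such that
`G_z = ⨁_{S_c < z} gr_c` for all `z ∈ U`. -/
structure DecompositionOn (S : SheafPair k) {E : Finset ℂ} (M : E → ModuleCat.{u} k)
    (U : Opens Cstar.{u}) where
  equiv : ∀ V : Opens Cstar.{u}, V ≤ U → (Sec S.L V ≃ₗ[k] ∀ c : E, LocallyConstant V (M c))
  equiv_res : ∀ {V W : Opens Cstar.{u}} (hV : V ≤ U) (hW : W ≤ V) (s : Sec S.L V) (c : E) (z : W),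
    equiv W (hW.trans hV) (res S.L hW s) c z = equiv V hV s c ⟨z.1, hW z.2⟩
  germ_mem_iff : ∀ (V : Opens Cstar.{u}) (hV : V ≤ U) (s : Sec S.L V) (z : V),
    germ S.L V z.1 z.2 s ∈ S.G.stalk z.1 ↔
      ∀ c : E, ¬ Outside (c : ℂ) z.1 → equiv V hV s c z = 0

/-- `(L, G)` is a co-Stokes sheaf with exponents `E`. -/
structure SheafPair.IsCoStokesSheaf (E : Finset ℂ) (S : SheafPair k) : Prop where
  isLocalSystem : IsLocalSystem S.L
  decomposition : ∀ z : Cstar.{u}, ∃ U : Opens Cstar.{u}, z ∈ U ∧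
    (∃ M : ModuleCat.{u} k, Nonempty (ConstantOn S.L U M)) ∧
    ∃ M : E → ModuleCat.{u} k, Nonempty (DecompositionOn S M U)

variable (k)

/-- The category of co-Stokes structures of exponential type. -/
abbrev Sto := ObjectProperty.FullSubcategory fun S : FilteredSheaf k => ∃ E, S.IsCoStokes E

/-- The category of co-Stokes sheaves. -/
abbrev SSh := ObjectProperty.FullSubcategory fun S : SheafPair k => ∃ E, S.IsCoStokesSheaf E

/-! ### The functor `σ` -/

variable {k}

/-- The subspace `L_{<ξ,θ}` of `(π^* L)_z`, for `z` with argument `θ`. -/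
def filAt (S : FilteredSheaf k) (ξ : ℂ) (z : Cstar.{u}) :
    Submodule k (Stalk ((pull k proj).obj S.L) z) :=
  ((S.fil ξ).stalk (proj z)).map (pullStalk proj S.L z)

/-- `(L, L_<) ↦ (π^* L, G)`, where `G` consists of the sections of `π^* L` whose germ at each `z`
lies in `L_{<ξ,θ}` for the `ξ` with `z ∈ S_ξ`. -/
def assemble (S : FilteredSheaf k) : SheafPair k where
  L := (pull k proj).obj S.L
  G := Subsheaf.ofStalks _ fun z => ⨅ (ξ : ℂ) (_ : z ∈ curve.{u} ξ), filAt S ξ z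

lemma onStalk_mem_stalk {S T : FilteredSheaf k} (f : S ⟶ T) (ξ : ℂ) (w : S1.{u})
    {a : Stalk S.L w} (ha : a ∈ (S.fil ξ).stalk w) : onStalk f.hom w a ∈ (T.fil ξ).stalk w := by
  obtain ⟨U, hU, s, hs, rfl⟩ := ha
  exact ⟨U, hU, _, f.map_fil ξ U s hs, (onStalk_germ f.hom U w hU s).symm⟩

variable (k) in
/-- Assembly as a functor, before restricting it to co-Stokes structures. -/
def assembleFunctor : FilteredSheaf k ⥤ SheafPair k where
  obj := assemble
  map {S T} f :=
    { hom := (pull k proj).map f.hom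
      map_sub := fun U s hs z hz => by
        have h := hs z hz
        have h' := onStalk_germ ((pull k proj).map f.hom) U z hz s
        simp only [Submodule.mem_iInf] at h ⊢
        intro ξ hξ
        obtain ⟨a, ha, he⟩ := h ξ hξ
        refine ⟨_, onStalk_mem_stalk f ξ _ ha, ?_⟩
        rw [← onStalk_pullStalk, he]
        exact h' }
  map_id S := SheafPair.Hom.ext ((pull k proj).map_id S.L)
  map_comp f g := SheafPair.Hom.ext ((pull k proj).map_comp f.hom g.hom)

/-- The functor `σ : Sto_< ⥤ SSh` obtained by restricting assembly to co-Stokes structures, given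
that it takes these to co-Stokes sheaves. -/
def sigma (h : ∀ (E : Finset ℂ) (S : FilteredSheaf k),
    S.IsCoStokes E → ((assembleFunctor k).obj S).IsCoStokesSheaf E) : Sto k ⥤ SSh k :=
  ObjectProperty.lift _ (ObjectProperty.ι _ ⋙ assembleFunctor k) fun S => by
    obtain ⟨E, hE⟩ := S.property
    exact ⟨E, h E S.obj hE⟩

/-! ### The functor `τ` -/

/-- The subspace of `L_x`, `x = r e^{iθ}`, that corresponds to `G_z ⊆ L_z`, `z = i_ξ(θ)`, under
`L_x ← L(I) → L_z`, where `I` is the ray through `x` and `z` and sections over `I` are given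
by sections over open neighbourhoods of `I`. -/
def transported (r : Set.Ioi (0 : ℝ)) (S : SheafPair k) (ξ : ℂ) (w : S1.{u}) :
    Submodule k (Stalk S.L (circ r w)) where
  carrier := {a | ∃ (U : Opens Cstar.{u}) (hU : ray w ⊆ U) (s : Sec S.L U),
    germ S.L U (circ r w) (hU (circ_mem_ray r w)) s = a ∧
    germ S.L U (param ξ w) (hU (param_mem_ray ξ w)) s ∈ S.G.stalk (param ξ w)}
  zero_mem' := ⟨⊤, fun _ _ => trivial, 0, map_zero _, by rw [map_zero]; exact zero_mem _⟩
  add_mem' := by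
    rintro _ _ ⟨U, hU, s, rfl, hs⟩ ⟨V, hV, t, rfl, ht⟩
    have h : ray w ⊆ (U ⊓ V : Opens Cstar.{u}) := fun z hz => ⟨hU hz, hV hz⟩
    refine ⟨U ⊓ V, h, res S.L inf_le_left s + res S.L inf_le_right t,
      by rw [map_add, germ_res, germ_res], ?_⟩
    rw [map_add, germ_res, germ_res]
    exact add_mem hs ht
  smul_mem' := by
    rintro a _ ⟨U, hU, s, rfl, hs⟩
    exact ⟨U, hU, a • s, map_smul _ _ _, by rw [map_smul]; exact Submodule.smul_mem _ _ hs⟩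

/-- The subspace `G_{i_ξ(θ)}` of the stalk of `i_∞^* L` at `θ`, where `i_∞` is the circle of
radius `r`. -/
def subAt (r : Set.Ioi (0 : ℝ)) (S : SheafPair k) (ξ : ℂ) (w : S1.{u}) :
    Submodule k (Stalk ((pull k (circ r)).obj S.L) w) :=
  (transported r S ξ w).map (pullStalk (circ r) S.L w)

/-- `(L, G) ↦ (i_∞^* L, i_ξ^* G)`, where `i_∞` is the circle of radius `r`. -/
def disassemble (r : Set.Ioi (0 : ℝ)) (S : SheafPair k) : FilteredSheaf k where
  L := (pull k (circ r)).obj S.L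
  fil ξ := Subsheaf.ofStalks _ (subAt r S ξ)

/-- The circle of radius `r` around `0` encircles all the curves `S_c`, `c ∈ E`. -/
def Encircles (r : Set.Ioi (0 : ℝ)) (E : Finset ℂ) : Prop :=
  ∀ c ∈ E, ∀ w : S1.{u}, ‖(param c w).down.1‖ < r

/-- `τ` is restriction to the circles: it is given on objects by `(L, G) ↦ (i_∞^* L, i_ξ^* G)` with
`i_∞` the circle of radius `r (L, G)`, and on morphisms by restriction of `f`, the circles of
different radii being identified along the rays. (If `r X = r Y`, the second condition says that
`τ f` is `i_∞^* f`.) -/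
def IsCircleRestriction (r : SSh k → Set.Ioi (0 : ℝ)) (τ : SSh k ⥤ Sto k) : Prop :=
  ∃ e : ∀ X : SSh k, (τ.obj X).obj ≅ disassemble (r X) X.obj,
    ∀ {X Y : SSh k} (f : X ⟶ Y) (w : S1.{u}) (U : Opens Cstar.{u}) (hU : ray w ⊆ U)
      (s : Sec X.obj.L U),
      onStalk ((e X).inv ≫ (τ.map f).hom ≫ (e Y).hom).hom w
          (pullStalk (circ (r X)) X.obj.L w
            (germ X.obj.L U (circ (r X) w) (hU (circ_mem_ray _ w)) s)) =
        pullStalk (circ (r Y)) Y.obj.L w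
          (germ Y.obj.L U (circ (r Y) w) (hU (circ_mem_ray _ w)) (onSec f.hom.hom U s))

end Categories

end CoStokes

end

open CoStokes

/-!
A *frame* of a sheaf over an open set is a linear family of sections that is bijective onto every
stalk; both kinds of objects are described by frames adapted to the exponents. For a co-Stokes
structure, the pullbacks of adapted frames are adapted to `π^* L`, since `S_c < z ↔ c <_θ ξ` for
`z ∈ S_ξ` of argument `θ`. The functor `π^*` is fully faithful on local systems because its fibres,
the rays, are connected.

The main point is that the local decompositions of a co-Stokes sheaf glue to an adapted frame over a
whole sector. Along a ray, the curves `S_c` are met at finitely many radii. Between these, two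
adapted splittings induce the same subspace `G_z`, so on moving outwards the pieces already crossed
can be kept from one splitting and the remaining ones taken from the other. Restriction of such
frames to a circle gives frames adapted to the filtrations. The rank of the `c`-th piece does not
depend on the frame: in all but finitely many directions the exponents have distinct real parts and
the ranks are read off from the filtration. Hence the graded pieces may be taken to be constant
sheaves. Extension along the rays inverts restriction to a circle.
-/

noncomputable section

namespace CoStokes

/-! ### Quasi-inverses of fully faithful functors -/

section PreimageFunctor

universe v₁ v₂ u₁ u₂

variable {C : Type u₁} [Category.{v₁} C] {D : Type u₂} [Category.{v₂} D] (F : C ⥤ D) [F.Full]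
  [F.Faithful] (G : D → C) (ε : ∀ X, F.obj (G X) ≅ X)

/-- The functor that takes each object `X` to a chosen preimage `G X` under a fully faithful functor
`F`, the morphisms being transported along the isomorphisms `F (G X) ≅ X`. -/
def preimageFunctor : D ⥤ C where
  obj := G
  map {X Y} f := F.preimage ((ε X).hom ≫ f ≫ (ε Y).inv)
  map_id X := F.map_injective (by simp)
  map_comp f g := F.map_injective (by simp)

lemma map_preimageFunctor_map {X Y : D} (f : X ⟶ Y) :
    F.map ((preimageFunctor F G ε).map f) ≫ (ε Y).hom = (ε X).hom ≫ f := by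
  simp [preimageFunctor]

/-- The equivalence given by a fully faithful functor and a choice of preimages of all objects. -/
def preimageEquivalence : C ≌ D :=
  CategoryTheory.Equivalence.mk F (preimageFunctor F G ε)
    (NatIso.ofComponents (fun X => F.preimageIso (ε (F.obj X)).symm)
      fun f => F.map_injective (by simp [preimageFunctor]))
    (NatIso.ofComponents ε fun f => map_preimageFunctor_map F G ε f)

end PreimageFunctor

/-! ### Splittings in modular lattices -/

section Splitting

variable {α ι : Type*} {N N' : ι → α} {A B : Set ι}

open Classical in
/-- The family that agrees with `N` on `A` and with `N'` elsewhere. -/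
def glue (N N' : ι → α) (A : Set ι) (i : ι) : α :=
  if i ∈ A then N i else N' i

lemma glue_of_mem {i : ι} (hi : i ∈ A) : glue N N' A i = N i := if_pos hi

lemma glue_of_notMem {i : ι} (hi : i ∉ A) : glue N N' A i = N' i := if_neg hi

variable [CompleteLattice α]

lemma biSup_glue_of_subset (hBA : B ⊆ A) : ⨆ i ∈ B, glue N N' A i = ⨆ i ∈ B, N i :=
  biSup_congr fun _ hi => glue_of_mem (hBA hi)

lemma biSup_glue_of_superset (hAB : A ⊆ B) (h : ⨆ i ∈ A, N i = ⨆ i ∈ A, N' i) :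
    ⨆ i ∈ B, glue N N' A i = ⨆ i ∈ B, N' i := by
  rw [← Set.union_sdiff_cancel hAB, iSup_union, iSup_union, biSup_glue_of_subset subset_rfl, h]
  exact congrArg _ (biSup_congr fun i hi => glue_of_notMem hi.2)

/-- The elements `N i` form an internal direct sum decomposition of `⊤`. -/
structure IsSplitting (N : ι → α) : Prop where
  iSupIndep : iSupIndep N
  iSup_eq_top : ⨆ i, N i = ⊤

lemma IsSplitting.map_orderIso {β : Type*} [CompleteLattice β] (h : IsSplitting N) (e : α ≃o β) :
    IsSplitting (e ∘ N) where
  iSupIndep := h.iSupIndep.map_orderIso e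
  iSup_eq_top := by simp only [Function.comp_apply, ← e.map_iSup, h.iSup_eq_top, e.map_top]

lemma IsSplitting.glue [IsModularLattice α] [Finite ι] (hN : IsSplitting N) (hN' : IsSplitting N')
    (h : ⨆ i ∈ A, N i = ⨆ i ∈ A, N' i) : IsSplitting (glue N N' A) where
  iSupIndep i := by
    by_cases hi : i ∈ A
    · have hdisj : Disjoint (⨆ j ∈ A, N j) (⨆ j ∈ Aᶜ, N' j) :=
        h ▸ hN'.iSupIndep.disjoint_biSup_biSup' disjoint_compl_right A.toFinite
      have hsup : N i ⊔ ⨆ j ∈ A \ {i}, N j ≤ ⨆ j ∈ A, N j :=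
        sup_le (le_biSup N hi) (biSup_mono fun _ hj => hj.1)
      rw [glue_of_mem hi]
      have hdisj' := (hN.iSupIndep.disjoint_biSup fun hi' : i ∈ A \ {i} => hi'.2 rfl)
        |>.disjoint_sup_right_of_disjoint_sup_left (hdisj.mono_left hsup)
      refine hdisj'.mono_right (iSup₂_le fun j hj => ?_)
      by_cases hjA : j ∈ A
      · rw [glue_of_mem hjA]
        exact (le_biSup N (show j ∈ A \ {i} from ⟨hjA, hj⟩)).trans le_sup_left
      · rw [glue_of_notMem hjA]
        exact (le_biSup N' (show j ∈ Aᶜ from hjA)).trans le_sup_right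
    · have hsub : A ⊆ {i}ᶜ := fun j hj => ne_of_mem_of_not_mem hj hi
      rw [glue_of_notMem hi]
      exact (hN'.iSupIndep i).mono_right (biSup_glue_of_superset hsub h).le
  iSup_eq_top := by
    rw [← iSup_univ, biSup_glue_of_superset A.subset_univ h, iSup_univ, hN'.iSup_eq_top]

end Splitting

section SplittingNearLine

open Filter Topology

variable {α ι T : Type*} [CompleteLattice α] [TopologicalSpace T] {G : T → ℝ → α} {f : ι → T → ℝ}
  {x : T} {N N' : ι → α} {s t : Set ℝ} {b : ℝ}

/-- For `y` near `x` and `t ∈ s`, the element `G y t` is the join of the `N i` with `f i y < t`; the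
condition on `y` does not depend on `t`. -/
def AdaptedNear (G : T → ℝ → α) (f : ι → T → ℝ) (x : T) (N : ι → α) (s : Set ℝ) : Prop :=
  ∀ᶠ y in 𝓝 x, ∀ t ∈ s, G y t = ⨆ i ∈ {i | f i y < t}, N i

/-- `G` is locally given by splittings with thresholds `f` along the line over `y`. -/
def LocallySplit (G : T → ℝ → α) (f : ι → T → ℝ) (y : T) : Prop :=
  ∀ t, ∃ N : ι → α, IsSplitting N ∧
    ∀ᶠ p : T × ℝ in 𝓝 (y, t), G p.1 p.2 = ⨆ i ∈ {i | f i p.1 < p.2}, N i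

lemma LocallySplit.eq_bot {y : T} (h : LocallySplit G f y) {t : ℝ} (ht : ∀ i, t ≤ f i y) :
    G y t = ⊥ := by
  obtain ⟨N, -, hN⟩ := h t
  rw [hN.self_of_nhds]
  exact iSup₂_eq_bot.2 fun i hi => absurd hi (ht i).not_gt

lemma LocallySplit.eq_top {y : T} (h : LocallySplit G f y) {t : ℝ} (ht : ∀ i, f i y < t) :
    G y t = ⊤ := by
  obtain ⟨N, hN, hGN⟩ := h t
  rw [hGN.self_of_nhds, ← hN.iSup_eq_top]
  exact iSup_congr fun i => iSup_pos (ht i)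

lemma LocallySplit.exists_adaptedNear_Ioo (h : LocallySplit G f x) (t : ℝ) :
    ∃ N : ι → α, IsSplitting N ∧ ∃ a b, t ∈ Set.Ioo a b ∧ AdaptedNear G f x N (Set.Ioo a b) := by
  obtain ⟨N, hN, hGN⟩ := h t
  rw [nhds_prod_eq, eventually_prod_iff] at hGN
  obtain ⟨P, hP, Q, hQ, hGN⟩ := hGN
  obtain ⟨a, b, ht, hab⟩ := mem_nhds_iff_exists_Ioo_subset.1 hQ
  exact ⟨N, hN, a, b, ht, hP.mono fun y hy t' ht' => hGN hy (hab ht')⟩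

variable [Finite ι]

lemma eventually_forall_lt_iff (hf : ∀ i, Continuous (f i)) (hb : ∀ i, f i x ≠ b) :
    ∀ᶠ y in 𝓝 x, ∀ i, f i y < b ↔ f i x < b := by
  refine eventually_all.2 fun i => ?_
  rcases (hb i).lt_or_gt with hi | hi
  · filter_upwards [(hf i).continuousAt.eventually_lt_const hi] with y hy
    exact iff_of_true hy hi
  · filter_upwards [(hf i).continuousAt.eventually_const_lt hi] with y hy
    exact iff_of_false hy.not_gt hi.not_gt

/-- Past a noncritical parameter `b` at which both families are adapted, the part of `N'` that has
been crossed can be replaced by the corresponding part of `N`. -/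
lemma AdaptedNear.glue (hN : AdaptedNear G f x N s) (hN' : AdaptedNear G f x N' t)
    (hf : ∀ i, Continuous (f i)) (hb : ∀ i, f i x ≠ b) (hs : s ⊆ Set.Iic b) (ht : t ⊆ Set.Ici b)
    (h : ⨆ i ∈ {i | f i x < b}, N i = ⨆ i ∈ {i | f i x < b}, N' i) :
    AdaptedNear G f x (glue N N' {i | f i x < b}) (s ∪ t) := by
  filter_upwards [hN, hN', eventually_forall_lt_iff hf hb] with y hy hy' hyb r hr
  rcases hr with hr | hr
  · exact (hy r hr).trans (biSup_glue_of_subset (B := {i | f i y < r})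
      fun i hi => (hyb i).1 (lt_of_lt_of_le hi (hs hr))).symm
  · exact (hy' r hr).trans (biSup_glue_of_superset (B := {i | f i y < r})
      (fun i hi => ((hyb i).2 hi).trans_le (ht hr)) h).symm

lemma exists_adaptedNear_union [IsModularLattice α] (hN : IsSplitting N)
    (hGN : AdaptedNear G f x N s) (hN' : IsSplitting N') (hGN' : AdaptedNear G f x N' t)
    (hf : ∀ i, Continuous (f i)) (hb : ∀ i, f i x ≠ b) (hs : s ⊆ Set.Iic b) (ht : t ⊆ Set.Ici b)
    (hbs : b ∈ s) (hbt : b ∈ t) :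
    ∃ N'' : ι → α, IsSplitting N'' ∧ AdaptedNear G f x N'' (s ∪ t) := by
  have h : ⨆ i ∈ {i | f i x < b}, N i = ⨆ i ∈ {i | f i x < b}, N' i :=
    (hGN.self_of_nhds b hbs).symm.trans (hGN'.self_of_nhds b hbt)
  exact ⟨_, hN.glue hN' h, hGN.glue hGN' hf hb hs ht h⟩

lemma LocallySplit.eventually_exists_adaptedNear_Iic [IsModularLattice α]
    (h : LocallySplit G f x) (hf : ∀ i, Continuous (f i)) (t : ℝ) :
    ∃ U ∈ 𝓝 t, ∀ b ∈ U, ∀ d ∈ U,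
      (∃ N : ι → α, IsSplitting N ∧ AdaptedNear G f x N (Set.Iic b)) →
        ∃ N : ι → α, IsSplitting N ∧ AdaptedNear G f x N (Set.Iic d) := by
  obtain ⟨N', hN', a, a', ht, hGN'⟩ := h.exists_adaptedNear_Ioo t
  refine ⟨Set.Ioo a a', Ioo_mem_nhds ht.1 ht.2, fun b hb d hd ⟨N, hN, hGN⟩ => ?_⟩
  obtain ⟨c, hc, hcf⟩ := (Set.Ioo_infinite (lt_min hb.1 hd.1)).exists_notMem_finite
    (Set.finite_range fun i => f i x)
  obtain ⟨hac, hcb, hcd⟩ : a < c ∧ c < b ∧ c < d := ⟨hc.1, lt_min_iff.1 hc.2⟩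
  rw [← Set.Iic_union_Icc_eq_Iic hcd.le]
  refine exists_adaptedNear_union hN (hGN.mono fun y hy r hr => hy r (hr.trans hcb.le)) hN'
    (hGN'.mono fun y hy r hr => hy r ⟨hac.trans_le hr.1, hr.2.trans_lt hd.2⟩) hf
    (fun i hi => hcf ⟨i, hi⟩) subset_rfl (fun r hr => hr.1) Set.self_mem_Iic ⟨le_rfl, hcd.le⟩

lemma exists_adaptedNear_univ [IsModularLattice α] (hf : ∀ i, Continuous (f i))
    (h : ∀ᶠ y in 𝓝 x, LocallySplit G f y) :
    ∃ N : ι → α, IsSplitting N ∧ AdaptedNear G f x N Set.univ := by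
  obtain ⟨a, ha⟩ := (eventually_all.2 fun i => eventually_lt_atBot (f i x)).exists
  obtain ⟨b, hb⟩ := (eventually_all.2 fun i => eventually_gt_atTop (f i x)).exists
  have below : ∃ N : ι → α, IsSplitting N ∧ AdaptedNear G f x N (Set.Iic a) := by
    obtain ⟨N, hN, -⟩ := h.self_of_nhds a
    refine ⟨N, hN, ?_⟩
    filter_upwards [h, eventually_all.2 fun i => (hf i).continuousAt.eventually_const_lt (ha i)]
      with y hy hya t ht
    rw [hy.eq_bot fun i => ht.trans (hya i).le]
    exact (iSup₂_eq_bot.2 fun i hi => absurd hi (ht.trans (hya i).le).not_gt).symm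
  obtain ⟨N, hN, hGN⟩ := PreconnectedSpace.induction₂' (fun c d =>
      (∃ N : ι → α, IsSplitting N ∧ AdaptedNear G f x N (Set.Iic c)) →
        ∃ N : ι → α, IsSplitting N ∧ AdaptedNear G f x N (Set.Iic d))
    (fun t => by
      obtain ⟨U, hU, hUQ⟩ := h.self_of_nhds.eventually_exists_adaptedNear_Iic hf t
      filter_upwards [hU] with d hd
      exact ⟨hUQ t (mem_of_mem_nhds hU) d hd, hUQ d hd t (mem_of_mem_nhds hU)⟩)
    ⟨fun _ _ _ hcd hde => hde ∘ hcd⟩ a b below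
  refine ⟨N, hN, ?_⟩
  filter_upwards [h, hGN, eventually_all.2 fun i => (hf i).continuousAt.eventually_lt_const (hb i)]
    with y hy hyN hyb t _
  rcases le_total t b with htb | hbt
  · exact hyN t htb
  · rw [hy.eq_top fun i => (hyb i).trans_le hbt, ← hN.iSup_eq_top]
    exact iSup_congr fun i => (iSup_pos (f := fun _ => N i) ((hyb i).trans_le hbt)).symm

end SplittingNearLine

/-! ### Splittings of modules -/

section ModuleSplitting

variable {R V ι : Type*} [Ring R] [AddCommGroup V] [Module R V] [Finite ι] [DecidableEq ι]

section Pi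

variable {M : ι → Type*} [∀ i, AddCommGroup (M i)] [∀ i, Module R (M i)]

lemma isSplitting_range_single : IsSplitting fun i => LinearMap.range (LinearMap.single R M i) where
  iSupIndep i := by
    simpa using LinearMap.disjoint_single_single R M {i} {i}ᶜ disjoint_compl_right
  iSup_eq_top := LinearMap.iSup_range_single R M

lemma isSplitting_map_range_single (B : (∀ i, M i) ≃ₗ[R] V) :
    IsSplitting fun i => (LinearMap.range (LinearMap.single R M i)).map B.toLinearMap :=
  isSplitting_range_single.map_orderIso (Submodule.orderIsoMapComap B)

lemma mem_biSup_map_range_single (B : (∀ i, M i) ≃ₗ[R] V) (A : Set ι) (v : V) :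
    v ∈ ⨆ i ∈ A, (LinearMap.range (LinearMap.single R M i)).map B.toLinearMap ↔
      ∀ i ∉ A, B.symm v i = 0 := by
  simp only [← Submodule.map_iSup, LinearMap.iSup_range_single_eq_iInf_ker_proj R M isCompl_compl
    A.toFinite, Submodule.mem_map_equiv, Submodule.mem_iInf, LinearMap.mem_ker,
    LinearMap.proj_apply, Set.mem_compl_iff]

end Pi

/-- The linear equivalence given by an internal direct sum decomposition. -/
def IsSplitting.piEquiv {N : ι → Submodule R V} (h : IsSplitting N) : (∀ i, N i) ≃ₗ[R] V :=
  have := Fintype.ofFinite ι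
  (DFinsupp.linearEquivFunOnFintype (R := R)).symm ≪≫ₗ h.iSupIndep.linearEquiv h.iSup_eq_top

lemma IsSplitting.piEquiv_single {N : ι → Submodule R V} (h : IsSplitting N) (i : ι) (v : N i) :
    h.piEquiv (Pi.single i v) = v := by
  simp [IsSplitting.piEquiv]

lemma IsSplitting.piEquiv_mem_biSup_iff {N : ι → Submodule R V} (h : IsSplitting N) (A : Set ι)
    (m : ∀ i, N i) : h.piEquiv m ∈ ⨆ i ∈ A, N i ↔ ∀ i ∉ A, m i = 0 := by
  have hN : (fun i => (LinearMap.range (LinearMap.single R (fun i => N i) i)).map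
      h.piEquiv.toLinearMap) = N := by
    funext i
    rw [← LinearMap.range_comp]
    refine (congrArg LinearMap.range (LinearMap.ext fun v => h.piEquiv_single i v)).trans
      (N i).range_subtype
  have := mem_biSup_map_range_single h.piEquiv A (h.piEquiv m)
  simp only [funext_iff.1 hN, LinearEquiv.symm_apply_apply] at this
  exact this

end ModuleSplitting

/-! ### Graded pieces of filtered modules -/

lemma exists_forall_lt_iff_le {ι α : Type*} [Finite ι] [LinearOrder α] [DenselyOrdered α]
    [NoMaxOrder α] [TopologicalSpace α] [OrderTopology α] (a : ι → α) (c : α) :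
    ∃ t, ∀ i, a i < t ↔ a i ≤ c := by
  have h : ∀ᶠ t in nhdsWithin c (Set.Ioi c), ∀ i, a i < t ↔ a i ≤ c := by
    refine Filter.eventually_all.2 fun i => ?_
    rcases le_or_gt (a i) c with hi | hi
    · filter_upwards [self_mem_nhdsWithin] with t ht
      exact iff_of_true (hi.trans_lt ht) hi
    · filter_upwards [Ioo_mem_nhdsGT hi] with t ht
      exact iff_of_false ht.2.not_gt hi.not_ge
  exact h.exists

/-- The hypotheses say that `A` maps the steps `< a c` and `≤ a c` of the filtrations by exponents
to each other, so that the diagonal entry is the `c`-th graded piece of `A`. -/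
lemma injective_proj_comp_single {R ι α : Type*} [Ring R] [DecidableEq ι] [PartialOrder α]
    {M M' : ι → Type*} [∀ i, AddCommGroup (M i)] [∀ i, Module R (M i)]
    [∀ i, AddCommGroup (M' i)] [∀ i, Module R (M' i)] {a : ι → α} (ha : Function.Injective a)
    (A : (∀ i, M i) →ₗ[R] ∀ i, M' i) (c : ι)
    (hlt : ∀ m, (∀ i, ¬ a i < a c → A m i = 0) → ∀ i, ¬ a i < a c → m i = 0)
    (hle : ∀ m, (∀ i, ¬ a i ≤ a c → m i = 0) → ∀ i, ¬ a i ≤ a c → A m i = 0) :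
    Function.Injective (LinearMap.proj c ∘ₗ A ∘ₗ LinearMap.single R M c) := by
  refine (injective_iff_map_eq_zero _).2 fun x hx => ?_
  have hx' : ∀ i, ¬ a i < a c → A (Pi.single c x) i = 0 := fun i hi => by
    rcases eq_or_ne i c with rfl | hic
    · exact hx
    · refine hle _ (fun j hj => Pi.single_eq_of_ne (by rintro rfl; exact hj le_rfl) x) i fun h => ?_
      exact hi (h.lt_of_ne (ha.ne hic))
  simpa using hlt _ hx' c (lt_irrefl _)

/-! ### Germs and sections -/

section Germs

open Filter Topology

variable {k : Type u} [Field k] {X Y : TopCat.{u}}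

lemma res_res (F : Sh k X) {U V W : Opens X} (h : V ≤ U) (h' : W ≤ V) (s : Sec F U) :
    res F h' (res F h s) = res F (h'.trans h) s :=
  (ConcreteCategory.congr_hom (F.presheaf.map_comp (homOfLE h).op (homOfLE h').op) s).symm

lemma pullSec_res (f : X ⟶ Y) (F : Sh k Y) {U V : Opens Y} (h : V ≤ U)
    (h' : (Opens.map f).obj V ≤ (Opens.map f).obj U) (s : Sec F U) :
    pullSec f F V (res F h s) = res ((pull k f).obj F) h' (pullSec f F U s) :=
  ConcreteCategory.congr_hom
    (((TopCat.Sheaf.pullbackPushforwardAdjunction (ModuleCat.{u} k) f).unit.app F).hom.naturality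
      (homOfLE h).op) s

lemma sec_ext (F : Sh k X) {U : Opens X} {s t : Sec F U}
    (h : ∀ x (hx : x ∈ U), germ F U x hx s = germ F U x hx t) : s = t :=
  TopCat.Presheaf.section_ext F U s t h

lemma exists_germ_eq (F : Sh k X) (x : X) (a : Stalk F x) :
    ∃ (U : Opens X) (hx : x ∈ U) (s : Sec F U), germ F U x hx s = a :=
  TopCat.Presheaf.exists_germ_eq F.presheaf a

lemma exists_res_eq_of_germ_eq (F : Sh k X) {U V : Opens X} {x : X} {hU : x ∈ U} {hV : x ∈ V}
    {s : Sec F U} {t : Sec F V} (h : germ F U x hU s = germ F V x hV t) :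
    ∃ (W : Opens X) (hWU : W ≤ U) (hWV : W ≤ V), x ∈ W ∧ res F hWU s = res F hWV t := by
  obtain ⟨W, hW, iU, iV, e⟩ := TopCat.Presheaf.germ_eq F.presheaf x hU hV s t h
  exact ⟨W, iU.le, iV.le, hW, e⟩

lemma germ_eq_of_res_eq (F : Sh k X) {U V W : Opens X} {hWU : W ≤ U} {hWV : W ≤ V}
    {s : Sec F U} {t : Sec F V} (h : res F hWU s = res F hWV t) (x : X) (hx : x ∈ W) :
    germ F U x (hWU hx) s = germ F V x (hWV hx) t := by
  rw [← germ_res F hWU x hx, h, germ_res]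

lemma eventually_germ_eq (F : Sh k X) {U V : Opens X} {x : X} {hU : x ∈ U} {hV : x ∈ V}
    {s : Sec F U} {t : Sec F V} (h : germ F U x hU s = germ F V x hV t) :
    ∀ᶠ y in 𝓝 x, ∀ (hy : y ∈ U) (hy' : y ∈ V), germ F U y hy s = germ F V y hy' t := by
  obtain ⟨W, _, _, hxW, e⟩ := exists_res_eq_of_germ_eq F h
  filter_upwards [W.isOpen.mem_nhds hxW] with y hy _ _
  exact germ_eq_of_res_eq F e y hy

lemma exists_section_of_germs (F : Sh k X) (U : Opens X) (b : ∀ x ∈ U, Stalk F x)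
    (h : ∀ x ∈ U, ∃ (V : Opens X) (s : Sec F V), x ∈ V ∧
      ∀ᶠ y in 𝓝 x, ∀ (hV : y ∈ V) (hU : y ∈ U), germ F V y hV s = b y hU) :
    ∃ s : Sec F U, ∀ x (hx : x ∈ U), germ F U x hx s = b x hx := by
  have h' : ∀ x ∈ U, ∃ (V : Opens X) (hV : V ≤ U) (_ : x ∈ V) (s : Sec F V),
      ∀ y (hy : y ∈ V), germ F V y hy s = b y (hV hy) := fun x hx => by
    obtain ⟨V, s, hxV, hs⟩ := h x hx
    obtain ⟨W, hW, hWo, hxW⟩ := eventually_nhds_iff.1 hs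
    refine ⟨U ⊓ V ⊓ ⟨W, hWo⟩, inf_le_left.trans inf_le_left, ⟨⟨hx, hxV⟩, hxW⟩,
      res F (inf_le_left.trans inf_le_right) s, fun y hy => ?_⟩
    rw [germ_res, hW y hy.2 hy.1.2 hy.1.1]
  choose V hV hxV s hs using h'
  obtain ⟨t, ht, -⟩ := F.existsUnique_gluing' (fun x : U => V x x.2) U (fun x => homOfLE (hV x x.2))
    (fun x hx => Opens.mem_iSup.2 ⟨⟨x, hx⟩, hxV x hx⟩) (fun x => s x x.2) fun x x' => by
      refine sec_ext F fun y hy => ?_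
      change germ F _ y hy (res F inf_le_left (s x x.2)) =
        germ F _ y hy (res F inf_le_right (s x' x'.2))
      rw [germ_res, germ_res, hs, hs]
  refine ⟨t, fun x hx => ?_⟩
  rw [← germ_res F (hV x hx) x (hxV x hx)]
  exact (congrArg _ (ht ⟨x, hx⟩)).trans (hs x hx x (hxV x hx))

lemma hom_ext_of_onStalk {F F' : Sh k X} {f g : F ⟶ F'}
    (h : ∀ x a, onStalk f x a = onStalk g x a) : f = g := by
  apply Sheaf.hom_ext
  ext U s
  induction U using Opposite.rec with | op U =>
  change onSec f U s = onSec g U s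
  refine sec_ext F' fun x hx => ?_
  rw [← onStalk_germ, ← onStalk_germ, h]

lemma isIso_of_onStalk_bijective {F F' : Sh k X} (f : F ⟶ F')
    (h : ∀ x, Function.Bijective (onStalk f x)) : IsIso f := by
  have : ∀ x : X, IsIso ((TopCat.Presheaf.stalkFunctor (ModuleCat.{u} k) x).map f.hom) :=
    fun x => (ConcreteCategory.isIso_iff_bijective _).2 (h x)
  exact TopCat.Presheaf.isIso_of_stalkFunctor_map_iso f

lemma onStalk_comp {F F' F'' : Sh k X} (f : F ⟶ F') (g : F' ⟶ F'') (x : X) (a : Stalk F x) :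
    onStalk (f ≫ g) x a = onStalk g x (onStalk f x a) :=
  ConcreteCategory.congr_hom
    ((TopCat.Presheaf.stalkFunctor (ModuleCat.{u} k) x).map_comp f.hom g.hom) a

lemma onStalk_id (F : Sh k X) (x : X) (a : Stalk F x) : onStalk (𝟙 F) x a = a :=
  ConcreteCategory.congr_hom
    ((TopCat.Presheaf.stalkFunctor (ModuleCat.{u} k) x).map_id F.presheaf) a

lemma onStalk_inv_hom {F F' : Sh k X} (f : F ≅ F') (x : X) (a : Stalk F x) :
    onStalk f.inv x (onStalk f.hom x a) = a := by
  rw [← onStalk_comp, f.hom_inv_id, onStalk_id]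

lemma onStalk_hom_inv {F F' : Sh k X} (f : F ≅ F') (x : X) (a : Stalk F' x) :
    onStalk f.hom x (onStalk f.inv x a) = a :=
  onStalk_inv_hom f.symm x a

namespace Subsheaf

variable {F : Sh k X}

lemma germ_mem_stalk (G : Subsheaf F) {U : Opens X} {s : Sec F U} (hs : s ∈ G.sec U) (x : X)
    (hx : x ∈ U) : germ F U x hx s ∈ G.stalk x :=
  ⟨U, hx, s, hs, rfl⟩

lemma germ_mem_stalk_congr (G : Subsheaf F) {U : Opens X} (s : Sec F U) {x y : X} (h : x = y)
    (hx : x ∈ U) (hy : y ∈ U) :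
    germ F U x hx s ∈ G.stalk x ↔ germ F U y hy s ∈ G.stalk y := by
  subst h
  rfl

lemma mem_sec_iff (G : Subsheaf F) {U : Opens X} {s : Sec F U} :
    s ∈ G.sec U ↔ ∀ x (hx : x ∈ U), germ F U x hx s ∈ G.stalk x := by
  refine ⟨fun h x hx => G.germ_mem_stalk h x hx, fun h => G.mem_of_locally s fun x hx => ?_⟩
  obtain ⟨V, hV, t, ht, e⟩ := h x hx
  obtain ⟨W, hWV, hWU, hW, e⟩ := exists_res_eq_of_germ_eq F e
  exact ⟨W, hWU, hW, e ▸ G.res_mem hWV ht⟩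

lemma eventually_germ_mem_stalk (G : Subsheaf F) {U : Opens X} {s : Sec F U} {x : X} {hx : x ∈ U}
    (h : germ F U x hx s ∈ G.stalk x) :
    ∀ᶠ y in 𝓝 x, ∀ hy : y ∈ U, germ F U y hy s ∈ G.stalk y := by
  obtain ⟨V, hV, t, ht, e⟩ := h
  filter_upwards [eventually_germ_eq F e, V.isOpen.mem_nhds hV] with y hy hyV hyU
  exact hy hyV hyU ▸ G.germ_mem_stalk ht y hyV

lemma stalk_ofStalks_le (P : ∀ x, Submodule k (Stalk F x)) (x : X) :
    (ofStalks F P).stalk x ≤ P x := by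
  rintro _ ⟨U, hU, s, hs, rfl⟩
  exact hs x hU

lemma germ_mem_stalk_ofStalks_iff (P : ∀ x, Submodule k (Stalk F x)) {U : Opens X} {s : Sec F U}
    {x : X} {hx : x ∈ U} : germ F U x hx s ∈ (ofStalks F P).stalk x ↔
      ∀ᶠ y in 𝓝 x, ∀ hy : y ∈ U, germ F U y hy s ∈ P y := by
  refine ⟨fun h => ?_, fun h => ?_⟩
  · filter_upwards [(ofStalks F P).eventually_germ_mem_stalk h] with y hy hyU
    exact stalk_ofStalks_le P y (hy hyU)
  · obtain ⟨W, hW, hWo, hxW⟩ := eventually_nhds_iff.1 h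
    refine ⟨U ⊓ ⟨W, hWo⟩, ⟨hx, hxW⟩, res F inf_le_left s, fun y hy => ?_, germ_res ..⟩
    rw [germ_res]
    exact hW y hy.2 hy.1

lemma onSec_mem_sec {F F' : Sh k X} {f : F ⟶ F'} {G : Subsheaf F} {G' : Subsheaf F'}
    (h : ∀ x, ∀ a ∈ G.stalk x, onStalk f x a ∈ G'.stalk x) {U : Opens X} {s : Sec F U}
    (hs : s ∈ G.sec U) : onSec f U s ∈ G'.sec U := by
  refine G'.mem_sec_iff.2 fun x hx => ?_
  rw [← onStalk_germ]
  exact h x _ (G.germ_mem_stalk hs x hx)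

end Subsheaf

lemma mem_sec_extByZero_iff (F : Sh k X) (O : Set X) {U : Opens X} (s : Sec F U) :
    s ∈ (extByZero F O).sec U ↔ ∀ x (hx : x ∈ U), x ∉ O → germ F U x hx s = 0 := by
  refine forall₂_congr fun x hx => ?_
  by_cases h : x ∈ O <;> simp [h]

end Germs

/-! ### Stalks of inverse images -/

section PullStalk

variable {k : Type u} [Field k] {X Y : TopCat.{u}}

lemma bijective_stalkFunctor_map_toSheafify (P : TopCat.Presheaf (ModuleCat.{u} k) X) (x : X) :
    Function.Bijective ((TopCat.Presheaf.stalkFunctor (ModuleCat.{u} k) x).map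
      (toSheafify (Opens.grothendieckTopology X) P)).hom :=
  have := TopCat.Presheaf.stalkFunctor_map_unit_toSheafify_isIso x (ModuleCat.{u} k) P
  ConcreteCategory.bijective_of_isIso _

/-- `pull k f` is only characterized as a left adjoint; this compares it with sheafification. -/
lemma exists_iso_pull_obj (f : X ⟶ Y) (F : Sh k Y) :
    ∃ φ : (pull k f).obj F ≅ (presheafToSheaf (Opens.grothendieckTopology X) (ModuleCat.{u} k)).obj
        ((TopCat.Presheaf.pullback (ModuleCat.{u} k) f).obj F.presheaf),
      ∀ (U : Opens Y) (s : Sec F U), onSec φ.hom ((Opens.map f).obj U) (pullSec f F U s) =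
        ((toSheafify (Opens.grothendieckTopology X)
          ((TopCat.Presheaf.pullback (ModuleCat.{u} k) f).obj F.presheaf)).app
            (op ((Opens.map f).obj U))).hom
          ((((TopCat.Presheaf.pullbackPushforwardAdjunction (ModuleCat.{u} k) f).unit.app
            F.presheaf).app (op U)).hom s) := by
  let adj := Functor.sheafPullbackConstruction.sheafAdjunctionContinuous (Opens.map f)
    (ModuleCat.{u} k) (Opens.grothendieckTopology Y) (Opens.grothendieckTopology X)
  let φ := Functor.sheafPullbackConstruction.sheafPullbackIso (Opens.map f) (ModuleCat.{u} k)
    (Opens.grothendieckTopology Y) (Opens.grothendieckTopology X)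
  have hφ : (TopCat.Sheaf.pullbackPushforwardAdjunction (ModuleCat.{u} k) f).unit.app F ≫
      (TopCat.Sheaf.pushforward _ f).map (φ.hom.app F) = adj.unit.app F :=
    Adjunction.unit_leftAdjointUniq_hom_app _ _ _
  exact ⟨φ.app F, fun U s => ConcreteCategory.congr_hom (congrArg (fun g => g.hom.app (op U)) hφ) s⟩

lemma pullStalk_bijective (f : X ⟶ Y) (F : Sh k Y) (x : X) :
    Function.Bijective (pullStalk f F x) := by
  obtain ⟨φ, hφ⟩ := exists_iso_pull_obj f F
  let P := (TopCat.Presheaf.pullback (ModuleCat.{u} k) f).obj F.presheaf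
  let η := (TopCat.Presheaf.stalkFunctor (ModuleCat.{u} k) x).map
    (toSheafify (Opens.grothendieckTopology X) P)
  have bijective_stalkPullbackHom : Function.Bijective
      (TopCat.Presheaf.stalkPullbackHom (ModuleCat.{u} k) f F.presheaf x).hom :=
    have := (TopCat.Presheaf.stalkPullbackIso (ModuleCat.{u} k) f F.presheaf x).isIso_hom
    ConcreteCategory.bijective_of_isIso
      (TopCat.Presheaf.stalkPullbackIso (ModuleCat.{u} k) f F.presheaf x).hom
  have bijective_onStalk : Function.Bijective (onStalk φ.hom x) :=
    Function.bijective_iff_has_inverse.2 ⟨_, onStalk_inv_hom φ x, onStalk_hom_inv φ x⟩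
  have comparison : onStalk φ.hom x ∘ pullStalk f F x =
      η.hom ∘ (TopCat.Presheaf.stalkPullbackHom (ModuleCat.{u} k) f F.presheaf x).hom := by
    funext a
    obtain ⟨U, hU, s, rfl⟩ := exists_germ_eq F (f x) a
    have hU' : x ∈ (Opens.map f).obj U := hU
    let t : P.obj (op ((Opens.map f).obj U)) :=
      (((TopCat.Presheaf.pullbackPushforwardAdjunction (ModuleCat.{u} k) f).unit.app
        F.presheaf).app (op U)).hom s
    have left : onStalk φ.hom x (pullStalk f F x (germ F U (f x) hU s)) =
        germ _ _ x hU' (onSec φ.hom _ (pullSec f F U s)) :=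
      (congrArg _ (pullStalk_germ f F x U hU hU' s)).trans (onStalk_germ φ.hom _ x hU' _)
    have right : (TopCat.Presheaf.stalkPullbackHom (ModuleCat.{u} k) f F.presheaf x).hom
        (germ F U (f x) hU s) = P.germ _ x hU' t := ConcreteCategory.congr_hom
      (TopCat.Presheaf.germ_stalkPullbackHom (ModuleCat.{u} k) f F.presheaf x U hU) s
    exact ((left.trans (congrArg _ (hφ U s))).trans
      (TopCat.Presheaf.stalkFunctor_map_germ_apply _ x hU' _ t).symm).trans
        (congrArg η.hom right.symm)
  rw [← Function.Bijective.of_comp_iff' bijective_onStalk, comparison]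
  exact (bijective_stalkFunctor_map_toSheafify P x).comp bijective_stalkPullbackHom

end PullStalk

/-! ### Frames of local systems -/

section Frames

open Filter Topology

variable {k : Type u} [Field k] {X Y : TopCat.{u}}

/-- A linear family of sections over `U`, indexed by a vector space `M`, that trivializes `F` on
`U`: evaluation identifies `M` with every stalk. -/
def IsFrame {F : Sh k X} {U : Opens X} {M : Type u} [AddCommGroup M] [Module k M]
    (σ : M →ₗ[k] Sec F U) : Prop :=
  ∀ x (hx : x ∈ U), Function.Bijective fun m => germ F U x hx (σ m)

namespace IsFrame

variable {F : Sh k X} {U : Opens X} {M : Type u} [AddCommGroup M] [Module k M]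
  {σ : M →ₗ[k] Sec F U}

lemma restrict (h : IsFrame σ) {V : Opens X} (hV : V ≤ U) : IsFrame (res F hV ∘ₗ σ) := by
  intro x hx
  simp only [LinearMap.comp_apply, germ_res]
  exact h x (hV hx)

lemma comp_equiv (h : IsFrame σ) {N : Type u} [AddCommGroup N] [Module k N] (e : N ≃ₗ[k] M) :
    IsFrame (σ ∘ₗ e.toLinearMap) :=
  fun x hx => (h x hx).comp e.bijective

lemma exists_eq (h : IsFrame σ) (x : X) (hx : x ∈ U) (a : Stalk F x) :
    ∃ m, germ F U x hx (σ m) = a := (h x hx).2 a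

/-- The isomorphism of `M` with the stalk given by a frame. -/
def stalkEquiv (h : IsFrame σ) (x : X) (hx : x ∈ U) : M ≃ₗ[k] Stalk F x :=
  LinearEquiv.ofBijective (germ F U x hx ∘ₗ σ) (h x hx)

lemma stalkEquiv_apply (h : IsFrame σ) (x : X) (hx : x ∈ U) (m : M) :
    h.stalkEquiv x hx m = germ F U x hx (σ m) := rfl

lemma germ_stalkEquiv_symm (h : IsFrame σ) (x : X) (hx : x ∈ U) (a : Stalk F x) :
    germ F U x hx (σ ((h.stalkEquiv x hx).symm a)) = a :=
  (h.stalkEquiv x hx).apply_symm_apply a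

/-- The function with values in `M` that corresponds to a section. -/
def coord (h : IsFrame σ) {V : Opens X} (hV : V ≤ U) (s : Sec F V) (x : V) : M :=
  (h.stalkEquiv x.1 (hV x.2)).symm (germ F V x.1 x.2 s)

lemma coord_eq_iff (h : IsFrame σ) {V : Opens X} (hV : V ≤ U) (s : Sec F V) (x : V) (m : M) :
    h.coord hV s x = m ↔ germ F V x.1 x.2 s = germ F U x.1 (hV x.2) (σ m) := by
  rw [coord, LinearEquiv.symm_apply_eq, stalkEquiv_apply]

lemma germ_coord (h : IsFrame σ) {V : Opens X} (hV : V ≤ U) (s : Sec F V) (x : V) :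
    germ F U x.1 (hV x.2) (σ (h.coord hV s x)) = germ F V x.1 x.2 s :=
  ((h.coord_eq_iff hV s x _).1 rfl).symm

lemma isLocallyConstant_coord (h : IsFrame σ) {V : Opens X} (hV : V ≤ U) (s : Sec F V) :
    IsLocallyConstant (h.coord hV s) := by
  refine (IsLocallyConstant.iff_eventually_eq _).2 fun x => ?_
  filter_upwards [continuous_subtype_val.continuousAt.eventually
    (eventually_germ_eq F (h.germ_coord hV s x))] with y hy
  exact (h.coord_eq_iff hV s y _).2 (hy (hV y.2) y.2).symm

lemma coord_injective (h : IsFrame σ) {V : Opens X} (hV : V ≤ U) :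
    Function.Injective (h.coord hV) := fun s t e =>
  sec_ext F fun x hx => by rw [← h.germ_coord hV s ⟨x, hx⟩, e, h.germ_coord]

lemma exists_coord_eq (h : IsFrame σ) {V : Opens X} (hV : V ≤ U) (f : LocallyConstant V M) :
    ∃ s : Sec F V, h.coord hV s = f := by
  obtain ⟨s, hs⟩ := exists_section_of_germs F V
    (fun x hx => germ F U x (hV hx) (σ (f ⟨x, hx⟩))) fun x hx => by
      refine ⟨U, σ (f ⟨x, hx⟩), hV hx, ?_⟩
      have hf : ∀ᶠ y in 𝓝 x, ∀ hy : y ∈ V, f ⟨y, hy⟩ = f ⟨x, hx⟩ := by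
        have := (IsLocallyConstant.iff_eventually_eq _).1 f.isLocallyConstant ⟨x, hx⟩
        rw [nhds_subtype_eq_comap, eventually_comap] at this
        exact this.mono fun y hy hyV => hy ⟨y, hyV⟩ rfl
      filter_upwards [hf] with y hy _ hyV
      rw [hy hyV]
  exact ⟨s, funext fun x => (h.coord_eq_iff hV s x _).2 (hs x.1 x.2)⟩

/-- Over the domain of a frame, sections are locally constant functions. -/
def secEquiv (h : IsFrame σ) (V : Opens X) (hV : V ≤ U) : Sec F V ≃ₗ[k] LocallyConstant V M :=
  LinearEquiv.ofBijective
    { toFun := fun s => ⟨h.coord hV s, h.isLocallyConstant_coord hV s⟩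
      map_add' := fun s t => by ext x; simp [coord]
      map_smul' := fun a s => by ext x; simp [coord] }
    ⟨fun _ _ e => h.coord_injective hV (congrArg (⇑) e), fun f =>
      (h.exists_coord_eq hV f).imp fun _ e => DFunLike.coe_injective e⟩

lemma secEquiv_eq_iff (h : IsFrame σ) {V : Opens X} (hV : V ≤ U) (s : Sec F V) (x : V) (m : M) :
    h.secEquiv V hV s x = m ↔ germ F V x.1 x.2 s = germ F U x.1 (hV x.2) (σ m) :=
  h.coord_eq_iff hV s x m

lemma germ_secEquiv (h : IsFrame σ) {V : Opens X} (hV : V ≤ U) (s : Sec F V) (x : V) :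
    germ F U x.1 (hV x.2) (σ (h.secEquiv V hV s x)) = germ F V x.1 x.2 s :=
  h.germ_coord hV s x

lemma secEquiv_res (h : IsFrame σ) {V W : Opens X} (hV : V ≤ U) (hW : W ≤ V) (s : Sec F V)
    (x : W) : h.secEquiv W (hW.trans hV) (res F hW s) x = h.secEquiv V hV s ⟨x.1, hW x.2⟩ := by
  rw [secEquiv_eq_iff, germ_res]
  exact (h.germ_secEquiv hV s ⟨x.1, hW x.2⟩).symm

/-- A frame identifies `F` with a constant sheaf. -/
def constantOn (h : IsFrame σ) : ConstantOn F U (ModuleCat.of k M) where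
  equiv := h.secEquiv
  equiv_res hV hW s x := h.secEquiv_res hV hW s x

lemma pullback {F : Sh k Y} {U : Opens Y} {σ : M →ₗ[k] Sec F U} (h : IsFrame σ) (f : X ⟶ Y) :
    IsFrame (pullSec f F U ∘ₗ σ) := by
  intro x hx
  have comp_eq : (fun m => germ ((pull k f).obj F) ((Opens.map f).obj U) x hx
      ((pullSec f F U ∘ₗ σ) m)) = pullStalk f F x ∘ fun m => germ F U (f x) hx (σ m) :=
    funext fun m => (pullStalk_germ f F x U hx hx (σ m)).symm
  rw [comp_eq]
  exact (pullStalk_bijective f F x).comp (h (f x) hx)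

end IsFrame

namespace ConstantOn

variable {F : Sh k X} {U : Opens X} {M : ModuleCat.{u} k}

/-- The sections that correspond to constant functions. -/
def frame (h : ConstantOn F U M) : M →ₗ[k] Sec F U :=
  (h.equiv U le_rfl).symm.toLinearMap ∘ₗ
    { toFun := LocallyConstant.const U
      map_add' := fun _ _ => rfl
      map_smul' := fun _ _ => rfl }

lemma equiv_frame (h : ConstantOn F U M) (m : M) (V : Opens X) (hV : V ≤ U) (x : V) :
    h.equiv V hV (res F hV (h.frame m)) x = m := by
  rw [h.equiv_res le_rfl hV]
  simp only [frame, LinearMap.comp_apply, LinearEquiv.coe_coe, LinearEquiv.apply_symm_apply]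
  rfl

lemma germ_frame_equiv (h : ConstantOn F U M) {V : Opens X} (hV : V ≤ U) (s : Sec F V) (x : V) :
    germ F U x.1 (hV x.2) (h.frame (h.equiv V hV s x)) = germ F V x.1 x.2 s := by
  obtain ⟨O, hO, hxO, e⟩ := (IsLocallyConstant.iff_exists_open _).1 (h.equiv V hV s).2 x
  obtain ⟨O', hO', rfl⟩ := isOpen_induced_iff.1 hO
  refine germ_eq_of_res_eq F (W := V ⊓ ⟨O', hO'⟩) (hWU := inf_le_left.trans hV)
    (hWV := inf_le_left) ?_ x.1 ⟨x.2, hxO⟩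
  refine (h.equiv _ (inf_le_left.trans hV)).injective (LocallyConstant.ext fun y => ?_)
  rw [h.equiv_frame, h.equiv_res hV]
  exact (e ⟨y.1, y.2.1⟩ y.2.2).symm

lemma isFrame (h : ConstantOn F U M) : IsFrame h.frame := by
  intro x hx
  constructor
  · intro m n e
    obtain ⟨W, hW, hW', hxW, e'⟩ := exists_res_eq_of_germ_eq F e
    rw [← h.equiv_frame m W hW ⟨x, hxW⟩, e', h.equiv_frame]
  · intro a
    obtain ⟨V, hxV, s, rfl⟩ := exists_germ_eq F x a
    refine ⟨h.equiv (U ⊓ V) inf_le_left (res F inf_le_right s) ⟨x, hx, hxV⟩, ?_⟩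
    exact (h.germ_frame_equiv inf_le_left _ ⟨x, hx, hxV⟩).trans (germ_res ..)

end ConstantOn

namespace IsLocalSystem

lemma exists_frame {F : Sh k X} (hF : IsLocalSystem F) (x : X) :
    ∃ U : Opens X, x ∈ U ∧ ∃ (M : ModuleCat.{u} k) (σ : M →ₗ[k] Sec F U),
      Module.Finite k M ∧ IsFrame σ := by
  obtain ⟨U, hU, M, hM, ⟨h⟩⟩ := hF x
  exact ⟨U, hU, M, h.frame, hM, h.isFrame⟩

lemma of_exists_frame {F : Sh k X} (h : ∀ x, ∃ U : Opens X, x ∈ U ∧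
    ∃ (M : ModuleCat.{u} k) (σ : M →ₗ[k] Sec F U), Module.Finite k M ∧ IsFrame σ) :
    IsLocalSystem F := by
  intro x
  obtain ⟨U, hU, M, σ, hM, h⟩ := h x
  exact ⟨U, hU, M, hM, ⟨h.constantOn⟩⟩

lemma finite_stalk {F : Sh k X} (hF : IsLocalSystem F) (x : X) : Module.Finite k (Stalk F x) := by
  obtain ⟨U, hU, M, σ, hM, hσ⟩ := hF.exists_frame x
  exact Module.Finite.equiv (hσ.stalkEquiv x hU)

lemma eventually_germ_eq_iff {F : Sh k X} (hF : IsLocalSystem F) {U V : Opens X} (s : Sec F U)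
    (t : Sec F V) {x : X} (hU : x ∈ U) (hV : x ∈ V) : ∀ᶠ y in 𝓝 x, ∀ (hyU : y ∈ U) (hyV : y ∈ V),
      germ F U y hyU s = germ F V y hyV t ↔ germ F U x hU s = germ F V x hV t := by
  obtain ⟨O, hO, M, σ, -, hσ⟩ := hF.exists_frame x
  obtain ⟨m, hm⟩ := hσ.exists_eq x hO (germ F U x hU s)
  obtain ⟨n, hn⟩ := hσ.exists_eq x hO (germ F V x hV t)
  filter_upwards [eventually_germ_eq F hm, eventually_germ_eq F hn, O.isOpen.mem_nhds hO]
    with y hmy hny hyO hyU hyV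
  rw [← hmy hyO hyU, ← hny hyO hyV, ← hm, ← hn]
  exact (hσ y hyO).1.eq_iff.trans (hσ x hO).1.eq_iff.symm

lemma germ_eq_of_isPreconnected {F : Sh k X} (hF : IsLocalSystem F) {C : Set X}
    (hC : IsPreconnected C) {U V : Opens X} (hU : C ⊆ U) (hV : C ⊆ V) {s : Sec F U} {t : Sec F V}
    {x : X} (hx : x ∈ C) (h : germ F U x (hU hx) s = germ F V x (hV hx) t) {y : X} (hy : y ∈ C) :
    germ F U y (hU hy) s = germ F V y (hV hy) t := by
  have : PreconnectedSpace C := isPreconnected_iff_preconnectedSpace.1 hC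
  let P : C → Prop := fun z => germ F U z (hU z.2) s = germ F V z (hV z.2) t
  have hP : IsLocallyConstant P := (IsLocallyConstant.iff_eventually_eq _).2 fun z => by
    filter_upwards [continuous_subtype_val.continuousAt.eventually
      (hF.eventually_germ_eq_iff s t (hU z.2) (hV z.2))] with v hv
    exact propext (hv _ _)
  exact (hP.apply_eq_of_preconnectedSpace ⟨y, hy⟩ ⟨x, hx⟩).mpr h

lemma pull_obj {F : Sh k Y} (hF : IsLocalSystem F) (f : X ⟶ Y) :
    IsLocalSystem ((pull k f).obj F) := by
  refine .of_exists_frame fun x => ?_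
  obtain ⟨U, hU, M, σ, hM, hσ⟩ := hF.exists_frame (f x)
  exact ⟨_, hU, M, _, hM, hσ.pullback f⟩

end IsLocalSystem

lemma exists_isFrame_top (X : TopCat.{u}) (M : ModuleCat.{u} k) :
    ∃ (F : Sh k X) (σ : M →ₗ[k] Sec F ⊤), IsFrame σ := by
  let P : TopCat.Presheaf (ModuleCat.{u} k) X := (Functor.const _).obj M
  let τ := toSheafify (Opens.grothendieckTopology X) P
  let F : Sh k X := (presheafToSheaf (Opens.grothendieckTopology X) (ModuleCat.{u} k)).obj P
  refine ⟨F, (τ.app (op ⊤)).hom, fun x hx => ?_⟩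
  have bijective_germ : Function.Bijective (P.germ ⊤ x hx).hom := by
    constructor
    · intro m n e
      obtain ⟨W, _, _, _, e⟩ := P.germ_eq x hx hx m n e
      exact e
    · intro a
      obtain ⟨U, hU, s, rfl⟩ := P.exists_germ_eq a
      exact ⟨s, (P.germ_res_apply (homOfLE le_top) x hU s).symm⟩
  have comp_eq : (fun m : M => germ F ⊤ x hx ((τ.app (op ⊤)).hom m)) =
      ((TopCat.Presheaf.stalkFunctor (ModuleCat.{u} k) x).map τ).hom ∘ (P.germ ⊤ x hx).hom :=
    funext fun m => (TopCat.Presheaf.stalkFunctor_map_germ_apply ⊤ x hx τ m).symm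
  rw [comp_eq]
  exact (bijective_stalkFunctor_map_toSheafify P x).comp bijective_germ

end Frames

/-! ### Polar coordinates -/

section Polar

/-- The point `e^t w`: polar coordinates with logarithmic radius. -/
def polar (w : S1.{u}) (t : ℝ) : Cstar.{u} :=
  ⟨⟨(Real.exp t : ℝ) * (w.down : ℂ), by simp [-Complex.ofReal_exp, Real.exp_ne_zero]⟩⟩

/-- The logarithm of the modulus: the second polar coordinate. -/
def logNorm (z : Cstar.{u}) : ℝ := Real.log ‖z.down.1‖

lemma proj_polar (w : S1.{u}) (t : ℝ) : proj (polar w t) = w :=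
  proj_real_mul _ (Real.exp_pos t) w _

lemma norm_polar (w : S1.{u}) (t : ℝ) : ‖(polar w t).down.1‖ = Real.exp t := by
  change ‖((Real.exp t : ℝ) : ℂ) * (w.down : ℂ)‖ = _
  rw [norm_mul, Circle.norm_coe, mul_one, Complex.norm_real,
    Real.norm_of_nonneg (Real.exp_pos t).le]

lemma norm_pos (z : Cstar.{u}) : 0 < ‖z.down.1‖ := norm_pos_iff.2 z.down.2

lemma polar_proj_logNorm (z : Cstar.{u}) : polar (proj z) (logNorm z) = z := by
  apply ULift.ext
  apply Subtype.ext
  change ((Real.exp (Real.log ‖z.down.1‖) : ℝ) : ℂ) * (z.down.1 / (‖z.down.1‖ : ℝ)) = z.down.1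
  have h : ((‖z.down.1‖ : ℝ) : ℂ) ≠ 0 := by exact_mod_cast (norm_pos z).ne'
  rw [Real.exp_log (norm_pos z)]
  field_simp

lemma exists_polar_eq (z : Cstar.{u}) : ∃ w t, polar w t = z := ⟨_, _, polar_proj_logNorm z⟩

lemma proj_surjective : Function.Surjective (proj.{u} : Cstar.{u} → S1.{u}) :=
  fun w => ⟨polar w 0, proj_polar w 0⟩

lemma continuous_polar : Continuous fun p : S1.{u} × ℝ => polar p.1 p.2 := by
  refine continuous_uliftUp.comp (Continuous.subtype_mk ?_ _)
  refine (Complex.continuous_ofReal.comp (Real.continuous_exp.comp continuous_snd)).mul ?_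
  exact continuous_subtype_val.comp (continuous_uliftDown.comp continuous_fst)

lemma continuous_logNorm : Continuous logNorm.{u} := by
  refine Continuous.log ?_ fun z => (norm_pos z).ne'
  exact (continuous_subtype_val.comp continuous_uliftDown).norm

lemma continuous_proj : Continuous (proj.{u} : Cstar.{u} → S1.{u}) := proj.hom.continuous

lemma param_eq_polar (ξ : ℂ) (w : S1.{u}) : param ξ w = polar w (ξ * (w.down : ℂ)⁻¹).re := rfl

lemma proj_param (ξ : ℂ) (w : S1.{u}) : proj (param ξ w) = w := proj_polar _ _

lemma proj_circ (r : Set.Ioi (0 : ℝ)) (w : S1.{u}) : proj (circ r w) = w := circ_mem_ray r w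

lemma outside_polar (c : ℂ) (w : S1.{u}) (t : ℝ) :
    Outside c (polar w t) ↔ (c * (w.down : ℂ)⁻¹).re < t := by
  rw [Outside, proj_polar, norm_polar, Real.exp_lt_exp]

lemma polar_mem_curve (c : ℂ) (w : S1.{u}) (t : ℝ) :
    polar w t ∈ curve.{u} c ↔ (c * (w.down : ℂ)⁻¹).re = t := by
  change ‖(polar w t).down.1‖ = _ ↔ _
  rw [proj_polar, norm_polar, Real.exp_eq_exp, eq_comm]

lemma param_mem_curve (ξ : ℂ) (w : S1.{u}) : param ξ w ∈ curve.{u} ξ :=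
  (polar_mem_curve _ _ _).2 rfl

lemma eq_param_of_mem_curve {ξ : ℂ} {z : Cstar.{u}} (hz : z ∈ curve.{u} ξ) :
    z = param ξ (proj z) := by
  obtain ⟨w, t, rfl⟩ := exists_polar_eq z
  rw [proj_polar, param_eq_polar, (polar_mem_curve _ _ _).1 hz]

lemma outside_iff_of_mem_curve {ξ c : ℂ} {z : Cstar.{u}} (hz : z ∈ curve.{u} ξ) :
    Outside c z ↔ LtAt (proj z) c ξ := by
  obtain ⟨w, t, rfl⟩ := exists_polar_eq z
  rw [outside_polar, proj_polar, LtAt, (polar_mem_curve _ _ _).1 hz]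

lemma re_real_mul_mul_inv (t : ℝ) (w : S1.{u}) : (t * (w.down : ℂ) * (w.down : ℂ)⁻¹).re = t := by
  rw [mul_inv_cancel_right₀ (Circle.coe_ne_zero _), Complex.ofReal_re]

lemma exists_mem_curve (z : Cstar.{u}) : ∃ ξ : ℂ, z ∈ curve.{u} ξ := by
  obtain ⟨w, t, rfl⟩ := exists_polar_eq z
  exact ⟨t * w.down, (polar_mem_curve _ _ _).2 (re_real_mul_mul_inv t w)⟩

lemma continuous_re_mul_inv (c : ℂ) : Continuous fun w : S1.{u} => (c * (w.down : ℂ)⁻¹).re := by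
  refine Complex.continuous_re.comp (continuous_const.mul ?_)
  exact (continuous_subtype_val.comp continuous_uliftDown).inv₀ fun w => Circle.coe_ne_zero _

lemma isOpen_ltAt (c ξ : ℂ) : IsOpen {w : S1.{u} | LtAt w c ξ} :=
  isOpen_lt (continuous_re_mul_inv c) (continuous_re_mul_inv ξ)

lemma isOpen_outside (c : ℂ) : IsOpen {z : Cstar.{u} | Outside c z} :=
  isOpen_lt (Real.continuous_exp.comp ((continuous_re_mul_inv c).comp continuous_proj))
    (continuous_subtype_val.comp continuous_uliftDown).norm

/-- The union of the rays through the points of `W`. -/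
abbrev sector (W : Opens S1.{u}) : Opens Cstar.{u} := (Opens.map proj).obj W

lemma sector_mono {U V : Opens S1.{u}} (h : V ≤ U) : sector V ≤ sector U := fun _ hz => h hz

lemma polar_mem_sector {U : Opens S1.{u}} {w : S1.{u}} (hw : w ∈ U) (t : ℝ) :
    polar w t ∈ sector U := by
  change proj (polar w t) ∈ U
  rwa [proj_polar]

lemma ray_subset_sector {U : Opens S1.{u}} {w : S1.{u}} (hw : w ∈ U) :
    ray w ⊆ (sector U : Set Cstar.{u}) := by
  rintro z rfl
  exact hw

lemma isPreconnected_preimage_proj {C : Set S1.{u}} (hC : IsPreconnected C) :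
    IsPreconnected (proj.{u} ⁻¹' C) := by
  have preimage_eq : proj.{u} ⁻¹' C = (fun p => polar p.1 p.2) '' (C ×ˢ Set.univ) := by
    ext z
    constructor
    · exact fun hz => ⟨(proj z, logNorm z), ⟨hz, trivial⟩, polar_proj_logNorm z⟩
    · rintro ⟨⟨w, t⟩, ⟨hw, -⟩, rfl⟩
      rwa [Set.mem_preimage, proj_polar]
  rw [preimage_eq]
  exact (hC.prod isPreconnected_univ).image _ continuous_polar.continuousOn

lemma isPreconnected_sector {W : Opens S1.{u}} (hW : IsPreconnected (W : Set S1.{u})) :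
    IsPreconnected (sector W : Set Cstar.{u}) :=
  isPreconnected_preimage_proj hW

lemma isPreconnected_ray (w : S1.{u}) : IsPreconnected (ray w) :=
  isPreconnected_preimage_proj isPreconnected_singleton

instance : LocallyPathConnectedSpace Circle :=
  (Circle.isCoveringMap_exp.isQuotientMap Circle.exp_surjective).locallyPathConnectedSpace

instance : LocallyConnectedSpace S1.{u} :=
  (Homeomorph.ulift.{u} (X := Circle)).isOpenEmbedding.locallyConnectedSpace

instance : LocallyConnectedSpace Cstar.{u} :=
  have : LocallyConnectedSpace {z : ℂ // z ≠ 0} :=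
    (isOpen_compl_singleton (x := (0 : ℂ))).isOpenEmbedding_subtypeVal.locallyConnectedSpace
  (Homeomorph.ulift.{u} (X := {z : ℂ // z ≠ 0})).isOpenEmbedding.locallyConnectedSpace

lemma exists_isPreconnected_opens {X : Type*} [TopologicalSpace X] [LocallyConnectedSpace X]
    {U : Opens X} {x : X} (hx : x ∈ U) :
    ∃ V : Opens X, V ≤ U ∧ x ∈ V ∧ IsPreconnected (V : Set X) := by
  obtain ⟨V, hV, hVo, hxV, hVc⟩ :=
    (locallyConnectedSpace_iff_subsets_isOpen_isConnected.1 ‹_›) x U (U.2.mem_nhds hx)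
  exact ⟨⟨V, hVo⟩, hV, hxV, hVc.isPreconnected⟩

end Polar

/-! ### Local systems on sectors -/

section Lifting

variable {k : Type u} [Field k] {X : TopCat.{u}} {F : Sh k X}

lemma IsLocalSystem.isCoveringMap [LocallyConnectedSpace X] (hF : IsLocalSystem F) :
    IsCoveringMap (TopCat.Presheaf.EtaleSpace.base (F := F.presheaf)) := by
  refine TopCat.Presheaf.EtaleSpace.isCoveringMap_base fun x => ?_
  obtain ⟨U, hU, M, σ, -, hσ⟩ := hF.exists_frame x
  obtain ⟨V, hV, hxV, hVc⟩ := exists_isPreconnected_opens hU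
  refine ⟨V, hxV, fun y hy => ⟨fun s t e => ?_, fun a => ?_⟩⟩
  · exact sec_ext F fun z hz => hF.germ_eq_of_isPreconnected hVc le_rfl le_rfl hy e hz
  · obtain ⟨m, hm⟩ := (hσ.restrict hV).exists_eq y hy a
    exact ⟨_, hm⟩

lemma exists_section_of_continuous {U : Opens X} (g : C(U, TopCat.Presheaf.EtaleSpace F.presheaf))
    (hg : ∀ x : U, (g x).base = x) :
    ∃ s : Sec F U, ∀ x : U, g x = ⟨x, germ F U x x.2 s⟩ := by
  have hb : ∀ y (hy : y ∈ U), ∃ b : Stalk F y, g ⟨y, hy⟩ = ⟨y, b⟩ := by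
    intro y hy
    have h : (g ⟨y, hy⟩).base = y := hg _
    generalize g ⟨y, hy⟩ = e at h
    subst h
    exact ⟨e.germ, rfl⟩
  choose b hb using hb
  obtain ⟨s, hs⟩ := exists_section_of_germs F U b fun y hy => by
    obtain ⟨V, hV, t, ht⟩ :=
      TopCat.Presheaf.EtaleSpace.exists_section_of_tendsto (g.continuous.tendsto ⟨y, hy⟩)
    rw [nhds_subtype_eq_comap, Filter.eventually_comap] at ht
    rw [hg ⟨y, hy⟩] at hV
    refine ⟨V, t, hV, ht.mono fun z hz _ hU => ?_⟩
    have h := hz ⟨z, hU⟩ rfl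
    rw [hb z hU] at h
    exact h.2.symm
  exact ⟨s, fun x => (hb x x.2).trans (by rw [hs])⟩

lemma IsLocalSystem.exists_section_germ_eq [LocallyConnectedSpace X] (hF : IsLocalSystem F)
    {A : Type*} [TopologicalSpace A] [SimplyConnectedSpace A] [LocallyPathConnectedSpace A]
    (f : C(A, X)) {U : Opens X} (ρ : C(U, A)) (hρ : ∀ x : U, f (ρ x) = x) (x : X) (hx : x ∈ U)
    (a : Stalk F x) : ∃ s : Sec F U, germ F U x hx s = a := by
  obtain ⟨g, ⟨hg0, hg⟩, -⟩ := hF.isCoveringMap.existsUnique_continuousMap_lifts f (ρ ⟨x, hx⟩)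
    ⟨x, a⟩ (hρ ⟨x, hx⟩).symm
  obtain ⟨s, hs⟩ := exists_section_of_continuous (g.comp ρ) fun y => (congrFun hg _).trans (hρ y)
  refine ⟨s, ?_⟩
  simpa using (hs ⟨x, hx⟩).symm.trans hg0

/-- The arc of the points of `S¹` that are not antipodal to `w`. -/
def arc (w : S1.{u}) : Opens S1.{u} :=
  ⟨{v | ((v.down / w.down : Circle) : ℂ) ∈ Complex.slitPlane},
    Complex.isOpen_slitPlane.preimage
      (continuous_subtype_val.comp (continuous_uliftDown.div_const w.down))⟩

lemma mem_arc (w : S1.{u}) : w ∈ arc w := by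
  change ((w.down / w.down : Circle) : ℂ) ∈ Complex.slitPlane
  simp

lemma mul_exp_arg_div (w v : Circle) : w * Circle.exp ((v / w : Circle) : ℂ).arg = v := by
  rw [Circle.exp_arg, mul_div_cancel]

/-- The universal covering `(θ, t) ↦ e^{t + iθ} w` of `ℂ*`. -/
def expMap (w : S1.{u}) : C(ℝ × ℝ, Cstar.{u}) where
  toFun p := polar ⟨w.down * Circle.exp p.1⟩ p.2
  continuous_toFun := continuous_polar.comp
    ((continuous_uliftUp.comp
      (continuous_const.mul (Circle.exp.continuous.comp continuous_fst))).prodMk continuous_snd)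

/-- The section of `expMap w` over the sector over `arc w` given by the principal argument. -/
def logMap (w : S1.{u}) : C(sector (arc w), ℝ × ℝ) where
  toFun z := ((((proj z.1).down / w.down : Circle) : ℂ).arg, logNorm z.1)
  continuous_toFun := by
    refine Continuous.prodMk ?_ (continuous_logNorm.comp continuous_subtype_val)
    rw [continuous_iff_continuousAt]
    intro z
    refine ContinuousAt.comp (f := fun z : sector (arc w) =>
      (((proj z.1).down / w.down : Circle) : ℂ)) (Complex.continuousAt_arg z.2) ?_
    exact (continuous_subtype_val.comp ((continuous_uliftDown.comp
      (continuous_proj.comp continuous_subtype_val)).div_const w.down)).continuousAt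

lemma expMap_logMap (w : S1.{u}) (z : sector (arc w)) : expMap w (logMap w z) = z :=
  (congrArg (fun v => polar ⟨v⟩ (logNorm z.1)) (mul_exp_arg_div _ _)).trans (polar_proj_logNorm _)

lemma IsLocalSystem.exists_sector_frame {F : Sh k Cstar.{u}} (hF : IsLocalSystem F) (w : S1.{u}) :
    ∃ W : Opens S1.{u}, w ∈ W ∧ ∃ (M : ModuleCat.{u} k) (σ : M →ₗ[k] Sec F (sector W)),
      Module.Finite k M ∧ IsFrame σ := by
  obtain ⟨W, hW, hwW, hWc⟩ := exists_isPreconnected_opens (mem_arc w)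
  have hle : sector W ≤ sector (arc w) := sector_mono hW
  have germ_bijective : ∀ x (hx : x ∈ sector W), Function.Bijective (germ F (sector W) x hx) := by
    refine fun x hx => ⟨fun s t e => ?_, fun a => ?_⟩
    · exact sec_ext F fun z hz => hF.germ_eq_of_isPreconnected (isPreconnected_sector hWc)
        le_rfl le_rfl hx e hz
    · obtain ⟨s, rfl⟩ :=
        hF.exists_section_germ_eq (expMap w) (logMap w) (expMap_logMap w) x (hle hx) a
      exact ⟨res F hle s, germ_res ..⟩
  let e := LinearEquiv.ofBijective _ (germ_bijective _ (polar_mem_sector hwW 0))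
  exact ⟨W, hwW, Stalk F (polar w 0), e.symm.toLinearMap, hF.finite_stalk _,
    fun x hx => (germ_bijective x hx).comp e.symm.bijective⟩

end Lifting

/-! ### Adapted frames -/

section AdaptedFrames

open Filter Topology

variable {k : Type u} [Field k] {X : TopCat.{u}}

/-- Locally constant functions with values in a finite product. -/
def locallyConstantPiEquiv {T : Type*} [TopologicalSpace T] {ι : Type*} [Finite ι]
    (M : ι → ModuleCat.{u} k) :
    LocallyConstant T (∀ i, M i) ≃ₗ[k] ∀ i, LocallyConstant T (M i) where
  toFun f i := f.map fun m => m i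
  map_add' _ _ := rfl
  map_smul' _ _ := rfl
  invFun g := ⟨fun t i => g i t, (IsLocallyConstant.iff_eventually_eq _).2 fun t =>
    (eventually_all.2 fun i =>
      (IsLocallyConstant.iff_eventually_eq _).1 (g i).isLocallyConstant t).mono fun _ => funext⟩
  left_inv _ := rfl
  right_inv _ := rfl

lemma eventually_forall_notMem_imp {ι : Type*} [Finite ι] {A : ι → Set X} (hA : ∀ i, IsOpen (A i))
    {p : ι → Prop} {x : X} (h : ∀ i, x ∉ A i → p i) : ∀ᶠ y in 𝓝 x, ∀ i, y ∉ A i → p i := by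
  refine eventually_all.2 fun i => ?_
  by_cases hx : x ∈ A i
  · filter_upwards [(hA i).mem_nhds hx] with y hy hy'
    exact absurd hy hy'
  · exact .of_forall fun _ _ => h i hx

lemma germ_mem_stalk_ofStalks_iff_forall_notMem {F : Sh k X} {U : Opens X} {ι : Type*} [Finite ι]
    {M : ι → ModuleCat.{u} k} {σ : (∀ i, M i) →ₗ[k] Sec F U} {P : ∀ x, Submodule k (Stalk F x)}
    {A : ι → Set X} (hA : ∀ i, IsOpen (A i))
    (hP : ∀ x (hx : x ∈ U) m, germ F U x hx (σ m) ∈ P x ↔ ∀ i, x ∉ A i → m i = 0)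
    (x : X) (hx : x ∈ U) (m : ∀ i, M i) :
    germ F U x hx (σ m) ∈ (Subsheaf.ofStalks F P).stalk x ↔ ∀ i, x ∉ A i → m i = 0 := by
  refine ⟨fun h => (hP x hx m).1 (Subsheaf.stalk_ofStalks_le P x h), fun h => ?_⟩
  rw [Subsheaf.germ_mem_stalk_ofStalks_iff]
  filter_upwards [eventually_forall_notMem_imp hA h] with y hy hyU
  exact (hP y hyU m).2 hy

/-- A frame of `S.L` indexed by a graded vector space, in which each `L_{<ξ}` is the sum of the
graded pieces with `c <_θ ξ`. -/
structure IsStokesFrame (S : FilteredSheaf k) {E : Finset ℂ} {M : E → ModuleCat.{u} k}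
    {U : Opens S1.{u}} (σ : (∀ c, M c) →ₗ[k] Sec S.L U) : Prop where
  isFrame : IsFrame σ
  mem_iff : ∀ w (hw : w ∈ U) (ξ : ℂ) (m : ∀ c, M c),
    germ S.L U w hw (σ m) ∈ (S.fil ξ).stalk w ↔ ∀ c : E, ¬ LtAt w c ξ → m c = 0

/-- A frame of `S.L` indexed by a graded vector space, in which `G_z` is the sum of the graded
pieces with `S_c < z`. -/
structure IsPairFrame (S : SheafPair k) {E : Finset ℂ} {M : E → ModuleCat.{u} k}
    {U : Opens Cstar.{u}} (σ : (∀ c, M c) →ₗ[k] Sec S.L U) : Prop where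
  isFrame : IsFrame σ
  mem_iff : ∀ z (hz : z ∈ U) (m : ∀ c, M c),
    germ S.L U z hz (σ m) ∈ S.G.stalk z ↔ ∀ c : E, ¬ Outside (c : ℂ) z → m c = 0

/-- The decomposition given by an adapted frame. -/
def IsPairFrame.decompositionOn {S : SheafPair k} {E : Finset ℂ} {M : E → ModuleCat.{u} k}
    {U : Opens Cstar.{u}} {σ : (∀ c, M c) →ₗ[k] Sec S.L U} (h : IsPairFrame S σ) :
    DecompositionOn S M U where
  equiv V hV := (h.isFrame.secEquiv V hV).trans (locallyConstantPiEquiv M)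
  equiv_res hV hW s c z := congrFun (h.isFrame.secEquiv_res hV hW s z) c
  germ_mem_iff V hV s z := by
    rw [← h.isFrame.germ_secEquiv hV s z, h.mem_iff]
    rfl

namespace DecompositionOn

variable {S : SheafPair k} {E : Finset ℂ} {M : E → ModuleCat.{u} k} {U : Opens Cstar.{u}}

/-- A decomposition makes the whole sheaf constant. -/
def constantOn (D : DecompositionOn S M U) : ConstantOn S.L U (ModuleCat.of k (∀ c, M c)) where
  equiv V hV := (D.equiv V hV).trans (locallyConstantPiEquiv M).symm
  equiv_res hV hW s z := funext fun c => D.equiv_res hV hW s c z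

lemma isPairFrame (D : DecompositionOn S M U) : IsPairFrame S D.constantOn.frame := by
  refine ⟨D.constantOn.isFrame, fun z hz m => ?_⟩
  have equiv_frame : ∀ c, D.equiv U le_rfl (res S.L le_rfl (D.constantOn.frame m)) c ⟨z, hz⟩ =
      m c := congrFun (D.constantOn.equiv_frame m U le_rfl ⟨z, hz⟩)
  rw [← germ_res S.L le_rfl z hz, D.germ_mem_iff U le_rfl _ ⟨z, hz⟩]
  simp only [equiv_frame]

end DecompositionOn

namespace GradedIsoOn

variable {S : FilteredSheaf k} {E : Finset ℂ} {gr : E → Sh k S1.{u}} {U V : Opens S1.{u}}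
  {M : E → ModuleCat.{u} k} {τ : ∀ c, M c →ₗ[k] Sec (gr c) V}

/-- Frames of the graded pieces make the whole sheaf constant. -/
def constantOn (D : GradedIsoOn S gr U) (hV : V ≤ U) (hτ : ∀ c, IsFrame (τ c)) :
    ConstantOn S.L V (ModuleCat.of k (∀ c, M c)) where
  equiv W hW := (D.equiv W (hW.trans hV)).symm.trans
    ((LinearEquiv.piCongrRight fun c => (hτ c).secEquiv W hW).trans (locallyConstantPiEquiv M).symm)
  equiv_res {W W'} hW hW' s x := by
    obtain ⟨t, rfl⟩ := (D.equiv W (hW.trans hV)).surjective s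
    rw [← D.equiv_res]
    simp only [LinearEquiv.trans_apply, LinearEquiv.symm_apply_apply]
    exact funext fun c => (hτ c).secEquiv_res hW hW' (t c) x

lemma constantOn_equiv_apply (D : GradedIsoOn S gr U) (hV : V ≤ U) (hτ : ∀ c, IsFrame (τ c))
    {W : Opens S1.{u}} (hW : W ≤ V) (t : ∀ c, Sec (gr c) W) (w : W) (c : E) :
    (D.constantOn hV hτ).equiv W hW (D.equiv W (hW.trans hV) t) w c =
      (hτ c).secEquiv W hW (t c) w := by
  simp only [constantOn, LinearEquiv.trans_apply, LinearEquiv.symm_apply_apply]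
  rfl

lemma res_frame_mem_fil_iff (D : GradedIsoOn S gr U) (hV : V ≤ U) (hτ : ∀ c, IsFrame (τ c))
    {W : Opens S1.{u}} (hW : W ≤ V) (ξ : ℂ) (m : ∀ c, M c) :
    res S.L hW ((D.constantOn hV hτ).frame m) ∈ (S.fil ξ).sec W ↔
      ∀ w ∈ W, ∀ c : E, ¬ LtAt w c ξ → m c = 0 := by
  obtain ⟨t, ht⟩ := (D.equiv W (hW.trans hV)).surjective
    (res S.L hW ((D.constantOn hV hτ).frame m))
  have coord_eq : ∀ (w : W) (c : E), (hτ c).secEquiv W hW (t c) w = m c := by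
    intro w c
    rw [← D.constantOn_equiv_apply, ht]
    exact congrFun ((D.constantOn hV hτ).equiv_frame m W hW w) c
  have germ_eq_zero_iff : ∀ (c : E) w (hw : w ∈ W), germ (gr c) W w hw (t c) = 0 ↔ m c = 0 := by
    intro c w hw
    rw [← coord_eq ⟨w, hw⟩ c, (hτ c).secEquiv_eq_iff]
    simp
  rw [← ht, D.mem_fil_iff]
  simp only [mem_sec_extByZero_iff, Set.mem_ofPred_eq, germ_eq_zero_iff]
  exact ⟨fun h w hw c => h c w hw, fun h c w hw => h w hw c⟩

lemma isStokesFrame (D : GradedIsoOn S gr U) (hV : V ≤ U) (hτ : ∀ c, IsFrame (τ c)) :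
    IsStokesFrame S (D.constantOn hV hτ).frame := by
  refine ⟨(D.constantOn hV hτ).isFrame, fun w hw ξ m => ?_⟩
  constructor
  · rintro ⟨W, hwW, s, hs, e⟩
    obtain ⟨W', hW'W, hW'V, hwW', e⟩ := exists_res_eq_of_germ_eq S.L e
    have h := (S.fil ξ).res_mem hW'W hs
    rw [e, D.res_frame_mem_fil_iff] at h
    exact h w hwW'
  · intro h
    obtain ⟨W, hW, hWo, hwW⟩ := eventually_nhds_iff.1
      (eventually_forall_notMem_imp (A := fun c : E => {w | LtAt w c ξ})
        (fun c => isOpen_ltAt c ξ) h)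
    exact ⟨V ⊓ ⟨W, hWo⟩, ⟨hw, hwW⟩, _,
      (D.res_frame_mem_fil_iff hV hτ inf_le_left ξ m).2 fun v hv => hW v hv.2, germ_res ..⟩

end GradedIsoOn

lemma FilteredSheaf.IsCoStokes.exists_frame {S : FilteredSheaf k} {E : Finset ℂ}
    (h : S.IsCoStokes E) (w : S1.{u}) : ∃ V : Opens S1.{u}, w ∈ V ∧
      ∃ (M : E → ModuleCat.{u} k) (σ : (∀ c, M c) →ₗ[k] Sec S.L V), IsStokesFrame S σ := by
  obtain ⟨gr, hgr, h⟩ := h.graded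
  obtain ⟨U, hU, ⟨D⟩⟩ := h w
  choose O hO M τ _ hτ using fun c => (hgr c).exists_frame w
  exact ⟨U ⊓ ⟨⋂ c, O c, isOpen_iInter_of_finite fun c => (O c).isOpen⟩,
    ⟨hU, Set.mem_iInter.2 hO⟩, M, _, D.isStokesFrame inf_le_left
      fun c => (hτ c).restrict (inf_le_right.trans (Set.iInter_subset _ c))⟩

end AdaptedFrames

/-! ### Assembly of co-Stokes structures -/

section Assemble

variable {k : Type u} [Field k] {S : FilteredSheaf k} {E : Finset ℂ}

lemma pullStalk_mem_filAt_iff {ξ : ℂ} {z : Cstar.{u}} (a : Stalk S.L (proj z)) :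
    pullStalk proj S.L z a ∈ filAt S ξ z ↔ a ∈ (S.fil ξ).stalk (proj z) :=
  (pullStalk_bijective proj S.L z).1.mem_set_image

lemma IsStokesFrame.germ_pullSec_mem_filAt_iff {M : E → ModuleCat.{u} k} {U : Opens S1.{u}}
    {σ : (∀ c, M c) →ₗ[k] Sec S.L U} (h : IsStokesFrame S σ) {ξ : ℂ} {z : Cstar.{u}}
    (hz : z ∈ sector U) (hξ : z ∈ curve.{u} ξ) (m : ∀ c, M c) :
    germ ((pull k proj).obj S.L) (sector U) z hz ((pullSec proj S.L U ∘ₗ σ) m) ∈ filAt S ξ z ↔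
      ∀ c : E, ¬ Outside (c : ℂ) z → m c = 0 := by
  rw [LinearMap.comp_apply, ← pullStalk_germ proj S.L z U hz hz, pullStalk_mem_filAt_iff]
  simp only [outside_iff_of_mem_curve hξ]
  exact h.mem_iff (proj z) hz ξ m

lemma IsStokesFrame.pullSec_comp {M : E → ModuleCat.{u} k} {U : Opens S1.{u}}
    {σ : (∀ c, M c) →ₗ[k] Sec S.L U} (h : IsStokesFrame S σ) :
    IsPairFrame (assemble S) (pullSec proj S.L U ∘ₗ σ) where
  isFrame := h.isFrame.pullback proj
  mem_iff := by
    refine germ_mem_stalk_ofStalks_iff_forall_notMem (A := fun c : E => {z | Outside (c : ℂ) z})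
      (fun c => isOpen_outside (c : ℂ)) fun z hz m => ?_
    obtain ⟨ξ, hξ⟩ := exists_mem_curve z
    have mem_iff := fun ξ hξ => h.germ_pullSec_mem_filAt_iff (ξ := ξ) hz hξ m
    change germ ((pull k proj).obj S.L) _ _ _ _ ∈ (⨅ (ξ) (_ : z ∈ curve.{u} ξ), filAt S ξ z) ↔ _
    simp only [Submodule.mem_iInf]
    exact ⟨fun H => (mem_iff ξ hξ).1 (H ξ hξ), fun H ξ hξ => (mem_iff ξ hξ).2 H⟩

lemma FilteredSheaf.IsCoStokes.isCoStokesSheaf_assemble (h : S.IsCoStokes E) :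
    (assemble S).IsCoStokesSheaf E where
  isLocalSystem := h.isLocalSystem.pull_obj proj
  decomposition z := by
    obtain ⟨V, hV, M, σ, hσ⟩ := h.exists_frame (proj z)
    exact ⟨sector V, hV, ⟨_, ⟨hσ.pullSec_comp.isFrame.constantOn⟩⟩,
      M, ⟨hσ.pullSec_comp.decompositionOn⟩⟩

lemma FilteredSheaf.IsCoStokes.stalk_assemble (h : S.IsCoStokes E) {ξ : ℂ} {z : Cstar.{u}}
    (hz : z ∈ curve.{u} ξ) : (assemble S).G.stalk z = filAt S ξ z := by
  obtain ⟨V, hV, M, σ, hσ⟩ := h.exists_frame (proj z)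
  ext a
  obtain ⟨m, rfl⟩ := hσ.pullSec_comp.isFrame.exists_eq z hV a
  rw [hσ.pullSec_comp.mem_iff z hV m]
  exact (hσ.germ_pullSec_mem_filAt_iff hV hz m).symm

end Assemble

/-! ### Full faithfulness of `σ` -/

section FullyFaithful

variable {k : Type u} [Field k] {X Y : TopCat.{u}}

lemma pull_map_injective {f : X ⟶ Y} (hf : Function.Surjective f) {L L' : Sh k Y} {g h : L ⟶ L'}
    (e : (pull k f).map g = (pull k f).map h) : g = h := by
  refine hom_ext_of_onStalk fun y a => ?_
  obtain ⟨x, rfl⟩ := hf y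
  apply (pullStalk_bijective f L' x).1
  rw [← onStalk_pullStalk, ← onStalk_pullStalk, e]

lemma exists_pull_map_eq {f : X ⟶ Y} {L L' : Sh k Y}
    [IsIso ((TopCat.Sheaf.pullbackPushforwardAdjunction (ModuleCat.{u} k) f).unit.app L')]
    (h : (pull k f).obj L ⟶ (pull k f).obj L') : ∃ g : L ⟶ L', (pull k f).map g = h := by
  let adj := TopCat.Sheaf.pullbackPushforwardAdjunction (ModuleCat.{u} k) f
  refine ⟨adj.homEquiv _ _ h ≫ inv (adj.unit.app L'), (adj.homEquiv _ _).injective ?_⟩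
  rw [adj.homEquiv_unit]
  refine (adj.unit_naturality _).trans ?_
  rw [Category.assoc, IsIso.inv_hom_id, Category.comp_id]

/-- The direct image `π_* L`. Its sections over `U` are those of `L` over the sector of `U`. -/
abbrev push (L : Sh k Cstar.{u}) : Sh k S1.{u} :=
  (TopCat.Sheaf.pushforward _ proj).obj L

lemma exists_germ_push_eq (L : Sh k Cstar.{u}) {w : S1.{u}} (a : Stalk (push L) w) :
    ∃ (U : Opens S1.{u}) (hU : w ∈ U) (s : Sec L (sector U)), germ (push L) U w hU s = a :=
  exists_germ_eq (push L) w a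

lemma IsLocalSystem.germ_push_eq {L : Sh k Cstar.{u}} (hL : IsLocalSystem L) {w : S1.{u}}
    {z : Cstar.{u}} (hz : z ∈ ray w) {U V : Opens S1.{u}} {hU : w ∈ U} {hV : w ∈ V}
    {s : Sec L (sector U)} {t : Sec L (sector V)}
    (h : germ L (sector U) z (ray_subset_sector hU hz) s =
      germ L (sector V) z (ray_subset_sector hV hz) t) :
    germ (push L) U w hU s = germ (push L) V w hV t := by
  obtain ⟨W, hW, hwW, hWc⟩ := exists_isPreconnected_opens (U := U ⊓ V) ⟨hU, hV⟩
  have hWU : W ≤ U := hW.trans inf_le_left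
  have hWV : W ≤ V := hW.trans inf_le_right
  have res_eq : res L (sector_mono hWU) s = res L (sector_mono hWV) t := sec_ext L fun x hx => by
    rw [germ_res, germ_res]
    exact hL.germ_eq_of_isPreconnected (isPreconnected_sector hWc) (sector_mono hWU)
      (sector_mono hWV) (ray_subset_sector hwW hz) h hx
  exact germ_eq_of_res_eq (push L) (hWU := hWU) (hWV := hWV) res_eq _ hwW

lemma stalkPushforward_germ_push (L : Sh k Cstar.{u}) (z : Cstar.{u}) (U : Opens S1.{u})
    (hU : proj z ∈ U) (s : Sec L (sector U)) :
    (TopCat.Presheaf.stalkPushforward (ModuleCat.{u} k) proj L.presheaf z).hom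
      (germ (push L) U (proj z) hU s) = germ L (sector U) z hU s :=
  ConcreteCategory.congr_hom (TopCat.Presheaf.stalkPushforward_germ _ proj L.presheaf U z hU) s

lemma IsLocalSystem.stalkPushforward_injective {L : Sh k Cstar.{u}} (hL : IsLocalSystem L)
    (z : Cstar.{u}) : Function.Injective
      (TopCat.Presheaf.stalkPushforward (ModuleCat.{u} k) proj L.presheaf z).hom := by
  intro a b e
  obtain ⟨U, hU, s, rfl⟩ := exists_germ_push_eq L a
  obtain ⟨V, hV, t, rfl⟩ := exists_germ_push_eq L b
  exact hL.germ_push_eq (w := proj z) rfl ((stalkPushforward_germ_push L z U hU s).symm.trans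
    (e.trans (stalkPushforward_germ_push L z V hV t)))

lemma IsLocalSystem.isIso_unit {L : Sh k S1.{u}} (hL : IsLocalSystem L) : IsIso
    ((TopCat.Sheaf.pullbackPushforwardAdjunction (ModuleCat.{u} k) proj.{u}).unit.app L) := by
  refine isIso_of_onStalk_bijective _ fun w => ?_
  obtain ⟨z, rfl⟩ := proj_surjective w
  have injective := (hL.pull_obj proj).stalkPushforward_injective z
  have bijective := pullStalk_bijective proj L z
  refine ⟨fun a b e => bijective.1 ?_, fun b => ?_⟩
  · exact congrArg (TopCat.Presheaf.stalkPushforward (ModuleCat.{u} k) proj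
      ((pull k proj).obj L).presheaf z).hom e
  · obtain ⟨a, ha⟩ := bijective.2
      ((TopCat.Presheaf.stalkPushforward (ModuleCat.{u} k) proj
        ((pull k proj).obj L).presheaf z).hom b)
    exact ⟨a, injective ha⟩

lemma SheafPair.Hom.onStalk_mem {S T : SheafPair k} (f : S ⟶ T) {z : Cstar.{u}}
    {a : Stalk S.L z} (ha : a ∈ S.G.stalk z) : onStalk f.hom z a ∈ T.G.stalk z := by
  obtain ⟨U, hU, s, hs, rfl⟩ := ha
  exact ⟨U, hU, _, f.map_sub U s hs, (onStalk_germ f.hom U z hU s).symm⟩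

lemma exists_assembleFunctor_map_eq {S T : FilteredSheaf k} {E E' : Finset ℂ}
    (hS : S.IsCoStokes E) (hT : T.IsCoStokes E') (h : assemble S ⟶ assemble T) :
    ∃ f : S ⟶ T, (assembleFunctor k).map f = h := by
  have := hT.isLocalSystem.isIso_unit
  obtain ⟨f, hf⟩ := exists_pull_map_eq h.hom
  refine ⟨⟨f, fun ξ U s hs => Subsheaf.onSec_mem_sec (fun w => ?_) hs⟩, SheafPair.Hom.ext hf⟩
  obtain ⟨z, hz, rfl⟩ : ∃ z ∈ curve.{u} ξ, proj z = w :=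
    ⟨param ξ w, param_mem_curve ξ w, proj_param ξ w⟩
  intro a ha
  rw [← pullStalk_mem_filAt_iff, ← hS.stalk_assemble hz] at ha
  rw [← pullStalk_mem_filAt_iff, ← onStalk_pullStalk, ← hT.stalk_assemble hz, hf]
  exact h.onStalk_mem ha

variable (h : ∀ (E : Finset ℂ) (S : FilteredSheaf k),
    S.IsCoStokes E → ((assembleFunctor k).obj S).IsCoStokesSheaf E)

instance sigma_faithful : (sigma h).Faithful where
  map_injective {S T f g} e := by
    have pull_map_eq : (pull k proj.{u}).map f.hom.hom = (pull k proj.{u}).map g.hom.hom :=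
      congrArg (fun φ => φ.hom.hom) e
    exact ObjectProperty.hom_ext _
      (FilteredSheaf.Hom.ext (pull_map_injective proj_surjective pull_map_eq))

instance sigma_full : (sigma h).Full where
  map_surjective {S T} g := by
    obtain ⟨E, hS⟩ := S.property
    obtain ⟨E', hT⟩ := T.property
    obtain ⟨f, hf⟩ := exists_assembleFunctor_map_eq hS hT g.hom
    exact ⟨ObjectProperty.homMk f, ObjectProperty.hom_ext _ hf⟩

end FullyFaithful

/-! ### Decompositions over sectors -/

section SectorFrame

open Filter Topology

variable {k : Type u} [Field k] {S : SheafPair k} {E : Finset ℂ}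

lemma SheafPair.IsCoStokesSheaf.exists_local_equiv (h : S.IsCoStokesSheaf E) {O : Opens Cstar.{u}}
    {V : ModuleCat.{u} k} {σ : V →ₗ[k] Sec S.L O} (hσ : IsFrame σ) {z : Cstar.{u}} (hz : z ∈ O) :
    ∃ (M : E → ModuleCat.{u} k) (B : (∀ c, M c) ≃ₗ[k] V) (U : Opens Cstar.{u}), U ≤ O ∧ z ∈ U ∧
      ∀ z' (hz' : z' ∈ O), z' ∈ U → ∀ v, germ S.L O z' hz' (σ v) ∈ S.G.stalk z' ↔
        ∀ c : E, ¬ Outside (c : ℂ) z' → B.symm v c = 0 := by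
  obtain ⟨U₀, hzU₀, -, M, ⟨D⟩⟩ := h.decomposition z
  have hD := D.isPairFrame
  obtain ⟨U, hU, hzU, hUc⟩ := exists_isPreconnected_opens (U := U₀ ⊓ O) ⟨hzU₀, hz⟩
  have hUU₀ : U ≤ U₀ := hU.trans inf_le_left
  have hUO : U ≤ O := hU.trans inf_le_right
  let B := (hD.isFrame.stalkEquiv z hzU₀).trans (hσ.stalkEquiv z hz).symm
  refine ⟨M, B, U, hUO, hzU, fun z' hz' hz'U v => ?_⟩
  have germ_eq : germ S.L U₀ z' (hUU₀ hz'U) (D.constantOn.frame (B.symm v)) =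
      germ S.L O z' hz' (σ v) :=
    h.isLocalSystem.germ_eq_of_isPreconnected hUc hUU₀ hUO hzU
      (hD.isFrame.germ_stalkEquiv_symm z hzU₀ _) hz'U
  rw [← germ_eq]
  exact hD.mem_iff z' _ _

/-- In a frame `σ` of `S.L` over the sector of `W`, the subspace of the vectors whose germ at the
point with direction `y` and logarithmic norm `t` lies in `S.G`. Only directions in `W` matter;
elsewhere the value is `⊥`. -/
def sectorFiltration {W : Opens S1.{u}} {V : ModuleCat.{u} k} (σ : V →ₗ[k] Sec S.L (sector W))
    (y : S1.{u}) (t : ℝ) : Submodule k V :=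
  ⨆ hy : y ∈ W, (S.G.stalk (polar y t)).comap
    (germ S.L (sector W) (polar y t) (polar_mem_sector hy t) ∘ₗ σ)

variable {W : Opens S1.{u}} {V : ModuleCat.{u} k} {σ : V →ₗ[k] Sec S.L (sector W)}

lemma mem_sectorFiltration {y : S1.{u}} (hy : y ∈ W) (t : ℝ) (v : V) :
    v ∈ sectorFiltration σ y t ↔ germ S.L (sector W) (polar y t) (polar_mem_sector hy t) (σ v) ∈
      S.G.stalk (polar y t) := by
  rw [sectorFiltration, iSup_pos hy]
  rfl

lemma SheafPair.IsCoStokesSheaf.locallySplit_sectorFiltration (h : S.IsCoStokesSheaf E)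
    (hσ : IsFrame σ) {y : S1.{u}} (hy : y ∈ W) :
    LocallySplit (sectorFiltration σ) (fun (c : E) (w : S1.{u}) => ((c : ℂ) * (w.down : ℂ)⁻¹).re)
      y := by
  classical
  intro t
  obtain ⟨M, B, U, -, hzU, hB⟩ := h.exists_local_equiv hσ (polar_mem_sector hy t)
  refine ⟨_, isSplitting_map_range_single B, ?_⟩
  have eventually_mem_U : ∀ᶠ p : S1.{u} × ℝ in 𝓝 (y, t), polar p.1 p.2 ∈ U :=
    continuous_polar.continuousAt.eventually_mem (U.2.mem_nhds hzU)
  have eventually_mem_W : ∀ᶠ p : S1.{u} × ℝ in 𝓝 (y, t), p.1 ∈ W :=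
    continuous_fst.continuousAt.eventually_mem (W.2.mem_nhds hy)
  filter_upwards [eventually_mem_U, eventually_mem_W] with p hpU hpW
  refine Submodule.ext fun v => ?_
  rw [mem_sectorFiltration hpW, hB _ _ hpU]
  simp only [outside_polar]
  exact (mem_biSup_map_range_single B {c : E | ((c : ℂ) * (p.1.down : ℂ)⁻¹).re < p.2} v).symm

lemma SheafPair.IsCoStokesSheaf.exists_sector_frame (h : S.IsCoStokesSheaf E) (w : S1.{u}) :
    ∃ W : Opens S1.{u}, w ∈ W ∧
      ∃ (M : E → ModuleCat.{u} k) (σ : (∀ c, M c) →ₗ[k] Sec S.L (sector W)),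
        (∀ c, Module.Finite k (M c)) ∧ IsPairFrame S σ := by
  classical
  obtain ⟨W₀, hw, V, σ, hV, hσ⟩ := h.isLocalSystem.exists_sector_frame w
  have mem_W₀ : ∀ᶠ y in 𝓝 w, y ∈ W₀ := W₀.2.mem_nhds hw
  obtain ⟨N, hN, hNG⟩ := exists_adaptedNear_univ (fun c : E => continuous_re_mul_inv (c : ℂ))
    (mem_W₀.mono fun y hy => h.locallySplit_sectorFiltration hσ hy)
  obtain ⟨W, hW, hWo, hwW⟩ := eventually_nhds_iff.1 (hNG.and mem_W₀)
  have hle : (⟨W, hWo⟩ : Opens S1.{u}) ≤ W₀ := fun y hy => (hW y hy).2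
  refine ⟨⟨W, hWo⟩, hwW, fun c => ModuleCat.of k (N c),
    res S.L (sector_mono hle) ∘ₗ σ ∘ₗ hN.piEquiv.toLinearMap,
    fun c => inferInstanceAs (Module.Finite k (N c)), (hσ.comp_equiv hN.piEquiv).restrict _, ?_⟩
  intro z hz m
  obtain ⟨y, t, rfl⟩ := exists_polar_eq z
  have hy : y ∈ W := proj_polar y t ▸ hz
  rw [LinearMap.comp_apply, germ_res]
  refine (mem_sectorFiltration (hle hy) t _).symm.trans ?_
  rw [(hW y hy).1 t (Set.mem_univ t)]
  refine (hN.piEquiv_mem_biSup_iff _ m).trans ?_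
  simp only [outside_polar, Set.mem_ofPred_eq]

end SectorFrame

/-! ### The graded pieces -/

section Graded

variable {k : Type u} [Field k] {S : FilteredSheaf k} {E : Finset ℂ}
  {M M' : E → ModuleCat.{u} k} {U U' : Opens S1.{u}}
  {σ : (∀ c, M c) →ₗ[k] Sec S.L U} {σ' : (∀ c, M' c) →ₗ[k] Sec S.L U'}

namespace IsStokesFrame

variable {gr : E → Sh k S1.{u}} {τ : ∀ c, M c →ₗ[k] Sec (gr c) ⊤}

/-- The isomorphism between a graded sheaf with constant pieces and `S.L` over the domain of an
adapted frame. -/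
def gradedEquiv (h : IsStokesFrame S σ) (hτ : ∀ c, IsFrame (τ c)) (V : Opens S1.{u}) (hV : V ≤ U) :
    (∀ c : E, Sec (gr c) V) ≃ₗ[k] Sec S.L V :=
  (LinearEquiv.piCongrRight fun c => (hτ c).secEquiv V le_top).trans
    ((locallyConstantPiEquiv M).symm.trans (h.isFrame.secEquiv V hV).symm)

lemma secEquiv_gradedEquiv (h : IsStokesFrame S σ) (hτ : ∀ c, IsFrame (τ c)) {V : Opens S1.{u}}
    (hV : V ≤ U) (t : ∀ c : E, Sec (gr c) V) (w : V) (c : E) :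
    h.isFrame.secEquiv V hV (h.gradedEquiv hτ V hV t) w c =
      (hτ c).secEquiv V le_top (t c) w := by
  simp only [gradedEquiv, LinearEquiv.trans_apply, LinearEquiv.apply_symm_apply]
  rfl

lemma gradedEquiv_mem_fil_iff (h : IsStokesFrame S σ) (hτ : ∀ c, IsFrame (τ c))
    {V : Opens S1.{u}} (hV : V ≤ U) (ξ : ℂ) (t : ∀ c : E, Sec (gr c) V) :
    h.gradedEquiv hτ V hV t ∈ (S.fil ξ).sec V ↔
      ∀ c : E, t c ∈ (extByZero (gr c) {w | LtAt w c ξ}).sec V := by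
  have coord_eq_zero_iff : ∀ w (hw : w ∈ V) (c : E),
      h.isFrame.secEquiv V hV (h.gradedEquiv hτ V hV t) ⟨w, hw⟩ c = 0 ↔
        germ (gr c) V w hw (t c) = 0 := by
    intro w hw c
    rw [h.secEquiv_gradedEquiv, (hτ c).secEquiv_eq_iff, map_zero, map_zero]
  have germ_mem_iff : ∀ w (hw : w ∈ V),
      germ S.L V w hw (h.gradedEquiv hτ V hV t) ∈ (S.fil ξ).stalk w ↔
        ∀ c : E, ¬ LtAt w c ξ → germ (gr c) V w hw (t c) = 0 := by
    intro w hw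
    rw [← h.isFrame.germ_secEquiv hV _ ⟨w, hw⟩, h.mem_iff]
    simp only [coord_eq_zero_iff]
  rw [Subsheaf.mem_sec_iff]
  simp only [germ_mem_iff, mem_sec_extByZero_iff, Set.mem_ofPred_eq]
  exact ⟨fun H c w hw => H w hw c, fun H w hw c => H c w hw⟩

/-- The grading given by an adapted frame and frames of the graded pieces. -/
def gradedIsoOn (h : IsStokesFrame S σ) (hτ : ∀ c, IsFrame (τ c)) : GradedIsoOn S gr U where
  equiv := h.gradedEquiv hτ
  equiv_res {V W} hV hW t := by
    refine (h.isFrame.secEquiv W (hW.trans hV)).injective ?_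
    ext w c
    rw [h.secEquiv_gradedEquiv, h.isFrame.secEquiv_res hV hW, h.secEquiv_gradedEquiv,
      (hτ c).secEquiv_res le_top hW]
  mem_fil_iff _ hV := h.gradedEquiv_mem_fil_iff hτ hV

end IsStokesFrame

instance : ConnectedSpace S1.{u} :=
  (Homeomorph.ulift.{u} (X := Circle)).symm.surjective.connectedSpace
    (Homeomorph.ulift.{u} (X := Circle)).symm.continuous

instance : Nontrivial S1.{u} :=
  ⟨⟨1⟩, ⟨-1⟩, fun h => Circle.neg_ne_self 1 (congrArg ULift.down h).symm⟩

lemma finite_setOf_re_mul_inv_eq_zero {d : ℂ} (hd : d ≠ 0) :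
    {w : S1.{u} | (d * (w.down : ℂ)⁻¹).re = 0}.Finite := by
  have inj : Function.Injective fun w : S1.{u} => d * (w.down : ℂ)⁻¹ := fun w w' e =>
    ULift.ext _ _ (Circle.ext (inv_injective (mul_left_cancel₀ hd e)))
  refine ((Set.toFinite {‖d‖ * Complex.I, -(‖d‖ * Complex.I)}).preimage inj.injOn).subset ?_
  intro w (hw : (d * (w.down : ℂ)⁻¹).re = 0)
  have abs_im_eq : |(d * (w.down : ℂ)⁻¹).im| = ‖d‖ := by
    rw [Complex.abs_im_eq_norm.2 hw, norm_mul, norm_inv, Circle.norm_coe w.down, inv_one, mul_one]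
  rcases (abs_eq (norm_nonneg d)).1 abs_im_eq with him | him
  · exact Or.inl (Complex.ext (by simp [hw]) (by simp [him]))
  · exact Or.inr (Complex.ext (by simp [hw]) (by simp [him]))

lemma exists_injOn_re_mul_inv (E : Finset ℂ) (hU : (U : Set S1.{u}).Nonempty) :
    ∃ v ∈ U, Set.InjOn (fun c : ℂ => (c * (v.down : ℂ)⁻¹).re) E := by
  have finite_bad : (⋃ p ∈ E.offDiag, {v : S1.{u} |
      ((p.1 - p.2) * (v.down : ℂ)⁻¹).re = 0}).Finite :=
    Set.Finite.biUnion (Finset.finite_toSet _) fun p hp =>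
      finite_setOf_re_mul_inv_eq_zero (sub_ne_zero.2 (Finset.mem_offDiag.1 hp).2.2)
  obtain ⟨w, hw⟩ := hU
  have infinite_U : (U : Set S1.{u}).Infinite := infinite_of_mem_nhds w (U.2.mem_nhds hw)
  obtain ⟨v, hvU, hv⟩ := infinite_U.exists_notMem_finite finite_bad
  refine ⟨v, hvU, fun c hc c' hc' e => by_contra fun hne => hv ?_⟩
  refine Set.mem_biUnion (x := (c, c')) (Finset.mem_offDiag.2 ⟨hc, hc', hne⟩) ?_
  change ((c - c') * (v.down : ℂ)⁻¹).re = 0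
  rw [sub_mul, Complex.sub_re, sub_eq_zero]
  exact e

namespace IsStokesFrame

lemma forall_not_lt_imp_iff (h : IsStokesFrame S σ) (h' : IsStokesFrame S σ') {v : S1.{u}}
    (hv : v ∈ U) (hv' : v ∈ U') (t : ℝ) (m : ∀ c, M c) :
    (∀ c : E, ¬ ((c : ℂ) * (v.down : ℂ)⁻¹).re < t →
      (h'.isFrame.stalkEquiv v hv').symm (h.isFrame.stalkEquiv v hv m) c = 0) ↔
    ∀ c : E, ¬ ((c : ℂ) * (v.down : ℂ)⁻¹).re < t → m c = 0 := by
  have ltAt_iff : ∀ c : E, LtAt v c (t * v.down) ↔ ((c : ℂ) * (v.down : ℂ)⁻¹).re < t :=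
    fun c => by rw [LtAt, re_real_mul_mul_inv]
  simp only [← ltAt_iff, ← h.mem_iff v hv, ← h'.mem_iff v hv', h'.isFrame.germ_stalkEquiv_symm]
  rfl

/-- In a direction in which the exponents have distinct real parts, the graded pieces are the
quotients of successive steps of the filtration, and such directions are dense. -/
lemma finrank_le (h : IsStokesFrame S σ) (h' : IsStokesFrame S σ') [∀ c, Module.Finite k (M' c)]
    (hU : ((U ⊓ U' : Opens S1.{u}) : Set S1.{u}).Nonempty) (c : E) :
    Module.finrank k (M c) ≤ Module.finrank k (M' c) := by
  classical
  obtain ⟨v, ⟨hv, hv'⟩, hinj⟩ := exists_injOn_re_mul_inv E hU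
  let A : (∀ c, M c) ≃ₗ[k] ∀ c, M' c :=
    (h.isFrame.stalkEquiv v hv).trans (h'.isFrame.stalkEquiv v hv').symm
  have hA : ∀ t m, (∀ c : E, ¬ ((c : ℂ) * (v.down : ℂ)⁻¹).re < t → A m c = 0) ↔
      ∀ c : E, ¬ ((c : ℂ) * (v.down : ℂ)⁻¹).re < t → m c = 0 :=
    h.forall_not_lt_imp_iff h' hv hv'
  obtain ⟨t, ht⟩ := exists_forall_lt_iff_le (fun d : E => ((d : ℂ) * (v.down : ℂ)⁻¹).re)
    ((c : ℂ) * (v.down : ℂ)⁻¹).re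
  refine LinearMap.finrank_le_finrank_of_injective
    (injective_proj_comp_single (a := fun d : E => ((d : ℂ) * (v.down : ℂ)⁻¹).re)
      hinj.injective A.toLinearMap c (fun m => (hA _ m).1) fun m => ?_)
  simp only [← ht]
  exact (hA t m).2

lemma comp_piCongrRight (h : IsStokesFrame S σ) (e : ∀ c, M' c ≃ₗ[k] M c) :
    IsStokesFrame S (σ ∘ₗ (LinearEquiv.piCongrRight e).toLinearMap) := by
  refine ⟨h.isFrame.comp_equiv _, fun w hw ξ m => (h.mem_iff w hw ξ _).trans ?_⟩
  exact forall_congr' fun c => imp_congr_right fun _ => (e c).map_eq_zero_iff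

end IsStokesFrame

lemma exists_gradedIsoOn_of_isStokesFrame
    (h : ∀ w : S1.{u}, ∃ U : Opens S1.{u}, w ∈ U ∧ ∃ (M : E → ModuleCat.{u} k)
      (σ : (∀ c, M c) →ₗ[k] Sec S.L U), (∀ c, Module.Finite k (M c)) ∧ IsStokesFrame S σ) :
    ∃ gr : E → Sh k S1.{u}, (∀ c, IsLocalSystem (gr c)) ∧
      ∀ w : S1.{u}, ∃ U : Opens S1.{u}, w ∈ U ∧ Nonempty (GradedIsoOn S gr U) := by
  choose U hU M σ hM hσ using h
  have finrank_eq : ∀ c w w', Module.finrank k (M w c) = Module.finrank k (M w' c) := by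
    intro c
    have locallyConstant : IsLocallyConstant fun w => Module.finrank k (M w c) := by
      rw [IsLocallyConstant.iff_exists_open]
      exact fun w => ⟨U w, (U w).2, hU w, fun v hv => le_antisymm
        ((hσ v).finrank_le (hσ w) ⟨v, hU v, hv⟩ c) ((hσ w).finrank_le (hσ v) ⟨v, hv, hU v⟩ c)⟩
    exact locallyConstant.apply_eq_of_preconnectedSpace
  let w₀ : S1.{u} := ⟨1⟩
  choose gr τ hτ using fun c => exists_isFrame_top S1.{u} (M w₀ c)
  refine ⟨gr, fun c => .of_exists_frame fun w => ⟨⊤, trivial, M w₀ c, τ c, hM w₀ c, hτ c⟩,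
    fun w => ⟨U w, hU w, ⟨IsStokesFrame.gradedIsoOn ((hσ w).comp_piCongrRight fun c => ?_) hτ⟩⟩⟩
  exact LinearEquiv.ofFinrankEq _ _ (finrank_eq c w₀ w)

end Graded

/-! ### Restriction to circles and extension along rays -/

section Circles

variable {k : Type u} [Field k] {L : Sh k Cstar.{u}}

lemma le_map_circ_sector (r : Set.Ioi (0 : ℝ)) (U : Opens S1.{u}) :
    U ≤ (Opens.map (circ r)).obj (sector U) := by
  intro w hw
  change proj (circ r w) ∈ U
  rwa [proj_circ]

/-- Restriction of sections over a sector to the circle of radius `r`. -/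
def restrictSec (r : Set.Ioi (0 : ℝ)) (L : Sh k Cstar.{u}) (U : Opens S1.{u}) :
    Sec L (sector U) →ₗ[k] Sec ((pull k (circ r)).obj L) U :=
  res ((pull k (circ r)).obj L) (le_map_circ_sector r U) ∘ₗ pullSec (circ r) L (sector U)

lemma restrictSec_res (r : Set.Ioi (0 : ℝ)) (L : Sh k Cstar.{u}) {U V : Opens S1.{u}} (h : V ≤ U)
    (s : Sec L (sector U)) : restrictSec r L V (res L (sector_mono h) s) =
      res ((pull k (circ r)).obj L) h (restrictSec r L U s) := by
  have h' : (Opens.map (circ r)).obj (sector V) ≤ (Opens.map (circ r)).obj (sector U) :=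
    fun w hw => sector_mono h hw
  rw [restrictSec, restrictSec, LinearMap.comp_apply, LinearMap.comp_apply,
    pullSec_res (circ r) L (sector_mono h) h', res_res, res_res]

lemma germ_restrictSec (r : Set.Ioi (0 : ℝ)) (L : Sh k Cstar.{u}) {U : Opens S1.{u}}
    {w : S1.{u}} (hw : w ∈ U) (s : Sec L (sector U)) :
    germ ((pull k (circ r)).obj L) U w hw (restrictSec r L U s) =
      pullStalk (circ r) L w
        (germ L (sector U) (circ r w) (ray_subset_sector hw (circ_mem_ray r w)) s) := by
  rw [restrictSec, LinearMap.comp_apply, germ_res]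
  exact (pullStalk_germ (circ r) L w (sector U) _ _ s).symm

lemma IsFrame.restrictSec_comp {W : Opens S1.{u}} {M : Type u} [AddCommGroup M] [Module k M]
    {σ : M →ₗ[k] Sec L (sector W)} (h : IsFrame σ) (r : Set.Ioi (0 : ℝ)) :
    IsFrame (restrictSec r L W ∘ₗ σ) := by
  intro w hw
  have germ_eq : (fun m => germ ((pull k (circ r)).obj L) W w hw ((restrictSec r L W ∘ₗ σ) m)) =
      pullStalk (circ r) L w ∘ fun m =>
        germ L (sector W) (circ r w) (ray_subset_sector hw (circ_mem_ray r w)) (σ m) :=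
    funext fun m => germ_restrictSec r L hw (σ m)
  rw [germ_eq]
  exact (pullStalk_bijective (circ r) L w).comp (h _ _)

/-- Restriction of sections over sectors to the circle of radius `r`, as a morphism. -/
def restrictCircle (r : Set.Ioi (0 : ℝ)) (L : Sh k Cstar.{u}) :
    push L ⟶ (pull k (circ r)).obj L :=
  ⟨{ app := fun U => ModuleCat.ofHom (restrictSec r L U.unop)
     naturality := fun U V f => by
      ext s
      exact restrictSec_res r L f.unop.le s }⟩

lemma onStalk_restrictCircle (r : Set.Ioi (0 : ℝ)) (L : Sh k Cstar.{u}) {U : Opens S1.{u}}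
    {w : S1.{u}} (hw : w ∈ U) (s : Sec L (sector U)) :
    onStalk (restrictCircle r L) w (germ (push L) U w hw s) =
      pullStalk (circ r) L w
        (germ L (sector U) (circ r w) (ray_subset_sector hw (circ_mem_ray r w)) s) :=
  (onStalk_germ (restrictCircle r L) U w hw s).trans (germ_restrictSec r L hw s)

lemma IsLocalSystem.exists_sector_germ_eq (hL : IsLocalSystem L) {w : S1.{u}} {z : Cstar.{u}}
    (hz : z ∈ ray w) (a : Stalk L z) : ∃ (U : Opens S1.{u}) (hU : w ∈ U) (s : Sec L (sector U)),
      germ L (sector U) z (ray_subset_sector hU hz) s = a := by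
  obtain ⟨W, hW, M, σ, -, hσ⟩ := hL.exists_sector_frame w
  obtain ⟨m, hm⟩ := hσ.exists_eq z (ray_subset_sector hW hz) a
  exact ⟨W, hW, σ m, hm⟩

lemma IsLocalSystem.exists_pullStalk_circ_eq (hL : IsLocalSystem L) (r : Set.Ioi (0 : ℝ))
    {w : S1.{u}} (a : Stalk ((pull k (circ r)).obj L) w) :
    ∃ (U : Opens S1.{u}) (hU : w ∈ U) (s : Sec L (sector U)), pullStalk (circ r) L w
      (germ L (sector U) (circ r w) (ray_subset_sector hU (circ_mem_ray r w)) s) = a := by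
  obtain ⟨b, rfl⟩ := (pullStalk_bijective (circ r) L w).2 a
  obtain ⟨U, hU, s, rfl⟩ := hL.exists_sector_germ_eq (circ_mem_ray r w) b
  exact ⟨U, hU, s, rfl⟩

lemma isIso_restrictCircle (hL : IsLocalSystem L) (r : Set.Ioi (0 : ℝ)) :
    IsIso (restrictCircle r L) := by
  refine isIso_of_onStalk_bijective _ fun w => ⟨fun a b e => ?_, fun a => ?_⟩
  · obtain ⟨U, hU, s, rfl⟩ := exists_germ_push_eq L a
    obtain ⟨V, hV, t, rfl⟩ := exists_germ_push_eq L b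
    rw [onStalk_restrictCircle, onStalk_restrictCircle] at e
    exact hL.germ_push_eq (circ_mem_ray r w) ((pullStalk_bijective (circ r) L w).1 e)
  · obtain ⟨U, hU, s, rfl⟩ := hL.exists_pullStalk_circ_eq r a
    exact ⟨germ (push L) U w hU s, onStalk_restrictCircle r L hU s⟩

/-- The extension of sections of `i^* L`, with `i` the circle of radius `r`, along the rays. -/
def extendRays (r : Set.Ioi (0 : ℝ)) (hL : IsLocalSystem L) :
    (pull k proj).obj ((pull k (circ r)).obj L) ⟶ L :=
  have := isIso_restrictCircle hL r
  ((TopCat.Sheaf.pullbackPushforwardAdjunction (ModuleCat.{u} k) proj).homEquiv _ _).symm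
    (inv (restrictCircle r L))

lemma onSec_extendRays (r : Set.Ioi (0 : ℝ)) (hL : IsLocalSystem L) (U : Opens S1.{u})
    (s : Sec L (sector U)) : onSec (extendRays r hL) (sector U)
      (pullSec proj ((pull k (circ r)).obj L) U (restrictSec r L U s)) = s := by
  have := isIso_restrictCircle hL r
  let adj := TopCat.Sheaf.pullbackPushforwardAdjunction (ModuleCat.{u} k) proj.{u}
  have unit_comp : adj.unit.app _ ≫ (TopCat.Sheaf.pushforward _ proj).map (extendRays r hL) =
      inv (restrictCircle r L) :=
    (adj.homEquiv_unit _ _ _).symm.trans (Equiv.apply_symm_apply _ _)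
  have restrictCircle_comp : restrictCircle r L ≫ adj.unit.app _ ≫
      (TopCat.Sheaf.pushforward _ proj).map (extendRays r hL) = 𝟙 _ := by
    rw [unit_comp, IsIso.hom_inv_id]
  exact congrArg (fun g => onSec g U s) restrictCircle_comp

lemma onStalk_extendRays_sector (r : Set.Ioi (0 : ℝ)) (hL : IsLocalSystem L) {z : Cstar.{u}}
    {U : Opens S1.{u}} (hU : proj z ∈ U) (s : Sec L (sector U)) :
    onStalk (extendRays r hL) z (pullStalk proj ((pull k (circ r)).obj L) z
      (pullStalk (circ r) L (proj z) (germ L (sector U) (circ r (proj z))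
        (ray_subset_sector hU (circ_mem_ray r _)) s))) = germ L (sector U) z hU s := by
  rw [← germ_restrictSec r L hU s]
  refine (congrArg _ (pullStalk_germ proj _ z U hU hU _)).trans ?_
  exact (onStalk_germ (extendRays r hL) (sector U) z hU _).trans
    (congrArg _ (onSec_extendRays r hL U s))

lemma onStalk_extendRays (r : Set.Ioi (0 : ℝ)) (hL : IsLocalSystem L) {z : Cstar.{u}}
    {U : Opens Cstar.{u}} (hU : ray (proj z) ⊆ U) (s : Sec L U) :
    onStalk (extendRays r hL) z (pullStalk proj ((pull k (circ r)).obj L) z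
      (pullStalk (circ r) L (proj z) (germ L U (circ r (proj z)) (hU (circ_mem_ray r _)) s))) =
      germ L U z (hU rfl) s := by
  obtain ⟨V, hV, t, ht⟩ := hL.exists_sector_germ_eq (circ_mem_ray r (proj z))
    (germ L U (circ r (proj z)) (hU (circ_mem_ray r _)) s)
  rw [← ht, onStalk_extendRays_sector r hL hV]
  exact hL.germ_eq_of_isPreconnected (isPreconnected_ray _) (ray_subset_sector hV) hU
    (circ_mem_ray r _) ht rfl

lemma onStalk_extendRays_bijective (r : Set.Ioi (0 : ℝ)) (hL : IsLocalSystem L) (z : Cstar.{u}) :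
    Function.Bijective (onStalk (extendRays r hL) z) := by
  refine ⟨fun a b e => ?_, fun a => ?_⟩
  · obtain ⟨a, rfl⟩ := (pullStalk_bijective proj _ z).2 a
    obtain ⟨b, rfl⟩ := (pullStalk_bijective proj _ z).2 b
    obtain ⟨U, hU, s, rfl⟩ := hL.exists_pullStalk_circ_eq r a
    obtain ⟨V, hV, t, rfl⟩ := hL.exists_pullStalk_circ_eq r b
    rw [onStalk_extendRays_sector r hL hU, onStalk_extendRays_sector r hL hV] at e
    rw [hL.germ_eq_of_isPreconnected (isPreconnected_ray _) (ray_subset_sector hU)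
      (ray_subset_sector hV) rfl e (circ_mem_ray r _)]
  · obtain ⟨U, hU, s, rfl⟩ := hL.exists_sector_germ_eq (w := proj z) rfl a
    exact ⟨_, onStalk_extendRays_sector r hL hU s⟩

/-- Extension along the rays as an isomorphism. -/
def extendRaysIso (r : Set.Ioi (0 : ℝ)) (hL : IsLocalSystem L) :
    (pull k proj).obj ((pull k (circ r)).obj L) ≅ L :=
  have := isIso_of_onStalk_bijective _ (onStalk_extendRays_bijective r hL)
  asIso (extendRays r hL)

lemma onStalk_eq_of_pull_map_comp_extendRays {r r' : Set.Ioi (0 : ℝ)} {L' : Sh k Cstar.{u}}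
    (hL : IsLocalSystem L) (hL' : IsLocalSystem L') {f : L ⟶ L'}
    {g : (pull k (circ r)).obj L ⟶ (pull k (circ r')).obj L'}
    (h : (pull k proj).map g ≫ extendRays r' hL' = extendRays r hL ≫ f) (w : S1.{u})
    {U : Opens Cstar.{u}} (hU : ray w ⊆ U) (s : Sec L U) :
    onStalk g w (pullStalk (circ r) L w (germ L U (circ r w) (hU (circ_mem_ray _ w)) s)) =
      pullStalk (circ r') L' w
        (germ L' U (circ r' w) (hU (circ_mem_ray _ w)) (onSec f U s)) := by
  obtain ⟨z, rfl⟩ := proj_surjective w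
  apply (pullStalk_bijective proj ((pull k (circ r')).obj L') z).1
  apply (onStalk_extendRays_bijective r' hL' z).1
  rw [onStalk_extendRays r' hL' hU, ← onStalk_pullStalk, ← onStalk_comp, h, onStalk_comp,
    onStalk_extendRays r hL hU, onStalk_germ]

end Circles

/-! ### Disassembly of co-Stokes sheaves -/

section Disassemble

variable {k : Type u} [Field k] {S T : SheafPair k} {E : Finset ℂ}

lemma pullStalk_mem_subAt_iff (hL : IsLocalSystem S.L) (r : Set.Ioi (0 : ℝ)) {ξ : ℂ}
    {z : Cstar.{u}} (hz : z ∈ curve.{u} ξ) {U : Opens Cstar.{u}} (hU : ray (proj z) ⊆ U)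
    (s : Sec S.L U) :
    pullStalk (circ r) S.L (proj z)
        (germ S.L U (circ r (proj z)) (hU (circ_mem_ray r _)) s) ∈ subAt r S ξ (proj z) ↔
      germ S.L U z (hU rfl) s ∈ S.G.stalk z := by
  rw [S.G.germ_mem_stalk_congr s (eq_param_of_mem_curve hz) _ (hU (param_mem_ray ξ (proj z)))]
  constructor
  · rintro ⟨_, ⟨V, hV, t, rfl, ht⟩, e⟩
    have germ_eq := (pullStalk_bijective (circ r) S.L (proj z)).1 e
    rwa [hL.germ_eq_of_isPreconnected (isPreconnected_ray _) hV hU (circ_mem_ray r _) germ_eq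
      (param_mem_ray ξ _)] at ht
  · exact fun h => ⟨_, ⟨U, hU, s, rfl, h⟩, rfl⟩

lemma IsPairFrame.germ_restrictSec_mem_subAt_iff {M : E → ModuleCat.{u} k} {W : Opens S1.{u}}
    {σ : (∀ c, M c) →ₗ[k] Sec S.L (sector W)} (h : IsPairFrame S σ) (hL : IsLocalSystem S.L)
    (r : Set.Ioi (0 : ℝ)) (ξ : ℂ) {w : S1.{u}} (hw : w ∈ W) (m : ∀ c, M c) :
    germ ((pull k (circ r)).obj S.L) W w hw ((restrictSec r S.L W ∘ₗ σ) m) ∈ subAt r S ξ w ↔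
      ∀ c : E, ¬ LtAt w c ξ → m c = 0 := by
  obtain ⟨z, hz, rfl⟩ : ∃ z ∈ curve.{u} ξ, proj z = w :=
    ⟨param ξ w, param_mem_curve ξ w, proj_param ξ w⟩
  rw [LinearMap.comp_apply, germ_restrictSec, pullStalk_mem_subAt_iff hL r hz, h.mem_iff]
  simp only [outside_iff_of_mem_curve hz]

lemma IsPairFrame.restrictSec_comp {M : E → ModuleCat.{u} k} {W : Opens S1.{u}}
    {σ : (∀ c, M c) →ₗ[k] Sec S.L (sector W)} (h : IsPairFrame S σ) (hL : IsLocalSystem S.L)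
    (r : Set.Ioi (0 : ℝ)) : IsStokesFrame (disassemble r S) (restrictSec r S.L W ∘ₗ σ) where
  isFrame := h.isFrame.restrictSec_comp r
  mem_iff w hw ξ m :=
    germ_mem_stalk_ofStalks_iff_forall_notMem (fun c : E => isOpen_ltAt (c : ℂ) ξ)
      (fun _ hw m => h.germ_restrictSec_mem_subAt_iff hL r ξ hw m) w hw m

lemma SheafPair.IsCoStokesSheaf.exists_stokesFrame_disassemble (h : S.IsCoStokesSheaf E)
    (r : Set.Ioi (0 : ℝ)) (w : S1.{u}) : ∃ W : Opens S1.{u}, w ∈ W ∧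
      ∃ (M : E → ModuleCat.{u} k) (σ : (∀ c, M c) →ₗ[k] Sec (disassemble r S).L W),
        (∀ c, Module.Finite k (M c)) ∧ IsStokesFrame (disassemble r S) σ := by
  obtain ⟨W, hW, M, σ, hM, hσ⟩ := h.exists_sector_frame w
  exact ⟨W, hW, M, _, hM, hσ.restrictSec_comp h.isLocalSystem r⟩

lemma SheafPair.IsCoStokesSheaf.isCoStokes_disassemble (h : S.IsCoStokesSheaf E)
    (r : Set.Ioi (0 : ℝ)) : (disassemble r S).IsCoStokes E where
  isLocalSystem := h.isLocalSystem.pull_obj (circ r)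
  stalk_mono w ξ₁ ξ₂ hlt := by
    obtain ⟨W, hW, M, σ, -, hσ⟩ := h.exists_stokesFrame_disassemble r w
    intro a ha
    obtain ⟨m, rfl⟩ := hσ.isFrame.exists_eq w hW a
    rw [hσ.mem_iff] at ha ⊢
    exact fun c hc => ha c fun hc' => hc (lt_trans hc' hlt)
  graded := exists_gradedIsoOn_of_isStokesFrame (h.exists_stokesFrame_disassemble r)

lemma SheafPair.IsCoStokesSheaf.stalk_disassemble (h : S.IsCoStokesSheaf E)
    (r : Set.Ioi (0 : ℝ)) (ξ : ℂ) (w : S1.{u}) :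
    ((disassemble r S).fil ξ).stalk w = subAt r S ξ w := by
  obtain ⟨W, hW, M, σ, -, hσ⟩ := h.exists_sector_frame w
  have hσr := hσ.restrictSec_comp h.isLocalSystem r
  ext a
  obtain ⟨m, rfl⟩ := hσr.isFrame.exists_eq w hW a
  rw [hσr.mem_iff w hW]
  exact (hσ.germ_restrictSec_mem_subAt_iff h.isLocalSystem r ξ hW m).symm

lemma SheafPair.IsCoStokesSheaf.onStalk_extendRays_mem_iff (h : S.IsCoStokesSheaf E)
    (r : Set.Ioi (0 : ℝ)) (z : Cstar.{u})
    (a : Stalk ((pull k proj).obj ((pull k (circ r)).obj S.L)) z) :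
    onStalk (extendRays r h.isLocalSystem) z a ∈ S.G.stalk z ↔
      a ∈ (assemble (disassemble r S)).G.stalk z := by
  obtain ⟨ξ, hξ⟩ := exists_mem_curve z
  obtain ⟨a, rfl⟩ := (pullStalk_bijective proj _ z).2 a
  obtain ⟨U, hU, s, rfl⟩ := h.isLocalSystem.exists_pullStalk_circ_eq r a
  rw [onStalk_extendRays_sector r h.isLocalSystem hU,
    (h.isCoStokes_disassemble r).stalk_assemble hξ]
  refine Iff.trans ?_ (pullStalk_mem_filAt_iff (S := disassemble r S) _).symm
  rw [h.stalk_disassemble]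
  exact (pullStalk_mem_subAt_iff h.isLocalSystem r hξ (ray_subset_sector hU) s).symm

/-- An isomorphism of sheaves that matches the stalks of the subsheaves, as an isomorphism of
pairs. -/
def SheafPair.isoMk (e : S.L ≅ T.L)
    (h : ∀ z a, onStalk e.hom z a ∈ T.G.stalk z ↔ a ∈ S.G.stalk z) : S ≅ T where
  hom := ⟨e.hom, fun _ _ => Subsheaf.onSec_mem_sec fun z a => (h z a).2⟩
  inv := ⟨e.inv, fun _ _ => Subsheaf.onSec_mem_sec fun z a ha =>
    (h z _).1 ((onStalk_hom_inv e z a).symm ▸ ha)⟩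
  hom_inv_id := SheafPair.Hom.ext e.hom_inv_id
  inv_hom_id := SheafPair.Hom.ext e.inv_hom_id

/-- Assembly after disassembly gives back a co-Stokes sheaf, by extension along the rays. -/
def assembleDisassembleIso (h : S.IsCoStokesSheaf E) (r : Set.Ioi (0 : ℝ)) :
    assemble (disassemble r S) ≅ S :=
  SheafPair.isoMk (extendRaysIso r h.isLocalSystem) (h.onStalk_extendRays_mem_iff r)

end Disassemble

/-! ### The quasi-inverse `τ` of `σ` -/

section Tau

variable {k : Type u} [Field k]

lemma assembleFunctor_obj_isCoStokesSheaf (E : Finset ℂ) (S : FilteredSheaf k)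
    (h : S.IsCoStokes E) : ((assembleFunctor k).obj S).IsCoStokesSheaf E :=
  h.isCoStokesSheaf_assemble

/-- Disassembly of the objects of `SSh`. -/
def disassembleObj (r : SSh k → Set.Ioi (0 : ℝ)) (X : SSh k) : Sto k :=
  ⟨disassemble (r X) X.obj, X.property.choose,
    X.property.choose_spec.isCoStokes_disassemble (r X)⟩

/-- The isomorphism `σ (τ X) ≅ X`. -/
def sigmaDisassembleIso (r : SSh k → Set.Ioi (0 : ℝ)) (X : SSh k) :
    (sigma assembleFunctor_obj_isCoStokesSheaf).obj (disassembleObj r X) ≅ X :=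
  ObjectProperty.isoMk _ (assembleDisassembleIso X.property.choose_spec (r X))

/-- The functor `τ`. On morphisms it is determined by full faithfulness of `σ`. -/
def tau (r : SSh k → Set.Ioi (0 : ℝ)) : SSh k ⥤ Sto k :=
  preimageFunctor (sigma assembleFunctor_obj_isCoStokesSheaf) (disassembleObj r)
    (sigmaDisassembleIso r)

/-- The equivalence given by `σ` and `τ`. -/
def sigmaEquivalence (r : SSh k → Set.Ioi (0 : ℝ)) : Sto k ≌ SSh k :=
  preimageEquivalence (sigma assembleFunctor_obj_isCoStokesSheaf) (disassembleObj r)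
    (sigmaDisassembleIso r)

lemma pull_map_tau_map (r : SSh k → Set.Ioi (0 : ℝ)) {X Y : SSh k} (f : X ⟶ Y) :
    (pull k proj).map ((tau r).map f).hom.hom ≫
        extendRays (r Y) Y.property.choose_spec.isLocalSystem =
      extendRays (r X) X.property.choose_spec.isLocalSystem ≫ f.hom.hom :=
  congrArg (fun g => g.hom.hom)
    (map_preimageFunctor_map (sigma assembleFunctor_obj_isCoStokesSheaf) (disassembleObj r)
      (sigmaDisassembleIso r) f)

lemma isCircleRestriction_tau (r : SSh k → Set.Ioi (0 : ℝ)) : IsCircleRestriction r (tau r) := by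
  refine ⟨fun X => Iso.refl _, fun {X Y} f w U hU s => ?_⟩
  have conj_refl : (Iso.refl (disassemble (r X) X.obj)).inv ≫ ((tau r).map f).hom ≫
      (Iso.refl (disassemble (r Y) Y.obj)).hom = ((tau r).map f).hom :=
    (Category.id_comp _).trans (Category.comp_id _)
  exact (congrArg (fun g => onStalk (FilteredSheaf.Hom.hom g) w _) conj_refl).trans
    (onStalk_eq_of_pull_map_comp_extendRays _ _ (pull_map_tau_map r f) w hU s)

end Tau

end CoStokes

end

theorem mainTheorem2_general {k : Type u} [Field k] :
    ∃ hσ : ∀ (E : Finset ℂ) (S : FilteredSheaf k),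
        S.IsCoStokes E → ((assembleFunctor k).obj S).IsCoStokesSheaf E,
      (∀ (S : Sto k) (ξ : ℂ), ∀ z ∈ curve.{u} ξ,
        ((sigma hσ).obj S).obj.G.stalk z = filAt S.obj ξ z) ∧
      (sigma hσ).IsEquivalence ∧
      (∀ (E : Finset ℂ) (S : SheafPair k) (r : Set.Ioi (0 : ℝ)), S.IsCoStokesSheaf E →
        (disassemble r S).IsCoStokes E ∧
          ∀ (ξ : ℂ) (w : S1.{u}), ((disassemble r S).fil ξ).stalk w = subAt r S ξ w) ∧
      ∀ r : SSh k → Set.Ioi (0 : ℝ), ∃ τ : SSh k ⥤ Sto k, IsCircleRestriction r τ ∧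
        ∃ e : Sto k ≌ SSh k, e.functor = sigma hσ ∧ e.inverse = τ := by
  refine ⟨assembleFunctor_obj_isCoStokesSheaf, fun S ξ z hz => ?_, ?_, fun E S r h => ?_,
    fun r => ⟨tau r, isCircleRestriction_tau r, sigmaEquivalence r, rfl, rfl⟩⟩
  · obtain ⟨E, hE⟩ := S.property
    exact hE.stalk_assemble hz
  · exact (sigmaEquivalence fun _ => ⟨1, Set.mem_Ioi.2 one_pos⟩).isEquivalence_functor
  · exact ⟨h.isCoStokes_disassemble r, h.stalk_disassemble r⟩

theorem mainTheorem2 {k : Type u} [Field k] :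
    ∃ hσ : ∀ (E : Finset ℂ) (S : FilteredSheaf k),
        S.IsCoStokes E → ((assembleFunctor k).obj S).IsCoStokesSheaf E,
      -- the stalk of `𝒢` at `z ∈ S_ξ` is `𝓛_{<ξ,θ}`
      (∀ (S : Sto k) (ξ : ℂ), ∀ z ∈ curve.{u} ξ,
        ((sigma hσ).obj S).obj.G.stalk z = filAt S.obj ξ z) ∧
      -- `σ` is an equivalence of categories
      (sigma hσ).IsEquivalence ∧
      -- restriction to the circles gives a co-Stokes structure with the same exponents, and
      -- the stalk of its `ξ`-th subsheaf at `θ` is `𝒢_{i_ξ(θ)}`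
      (∀ (E : Finset ℂ) (S : SheafPair k) (r : Set.Ioi (0 : ℝ)), S.IsCoStokesSheaf E →
        Encircles.{u} r E → (disassemble r S).IsCoStokes E ∧
          ∀ (ξ : ℂ) (w : S1.{u}), ((disassemble r S).fil ξ).stalk w = subAt r S ξ w) ∧
      -- it is a functor `τ` (for any choice of circles `S_∞`), and is quasi-inverse to `σ`
      ∀ r : SSh k → Set.Ioi (0 : ℝ),
        (∀ X : SSh k, ∃ E, X.obj.IsCoStokesSheaf E ∧ Encircles.{u} (r X) E) →
          ∃ τ : SSh k ⥤ Sto k, IsCircleRestriction r τ ∧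
            ∃ e : Sto k ≌ SSh k, e.functor = sigma hσ ∧ e.inverse = τ := by
  obtain ⟨hσ, stalk_eq, isEquivalence, isCoStokes, exists_quasiInverse⟩ :=
    mainTheorem2_general (k := k)
  exact ⟨hσ, stalk_eq, isEquivalence, fun E S r h _ => isCoStokes E S r h,
    fun r _ => exists_quasiInverse r⟩
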